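/- All rings are commutative. A Hopf algebroid $(A,\Gamma)$ consists of rings $A,\Gamma$ and ring homomorphisms $\eta_L,\eta_R:A\to\Gamma$, $\epsilon:\Gamma\to A$, $\Delta:\Gamma\to\Gamma\otimes_{\eta_R,A,\eta_L}\Gamma$ and $c:\Gamma\to\Gamma$ such that, for every ring $T$, the sets $\mathrm{Hom}(A,T)$ of objects and $\mathrm{Hom}(\Gamma,T)$ of morphisms form a groupoid with source, target, identities, composition and inversion induced by $\eta_L,\eta_R,\epsilon,\Delta,c$ respectively; it is flat if $\eta_L$ is flat. A right $\Gamma$-comodule is an $A$-module $M$ with a co-associative and co-unitary map $\psi_M:M\to M\otimes_{A,\eta_L}\Gamma$ that is $A$-linear for the $A$-module structure on the target given by $\eta_R$. Morphisms of comodules are the $A$-linear maps commuting with the structure maps, and $\mathrm{RCoMod}_\Gamma$ denotes the resulting category. A morphism $(f_o,f_m):(A,\Gamma)\to(B,\Sigma)$ of Hopf algebroids induces a functor $(f_o,f_m)^*:\mathrm{RCoMod}_\Gamma\to\mathrm{RCoMod}_\Sigma$, which sends $M$ to $M\otimes_A B$ with the structure map induced by $$M\xrightarrow{\psi_M}M\otimes_{A,\eta_L}\Gamma\xrightarrow{\mathrm{id}\otimes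 f_m}M\otimes_{A,\eta_L f_o}\Sigma\cong(M\otimes_A B)\otimes_{B,\eta_L}\Sigma .$$ For a Hopf algebroid $(A,\Gamma)$ and a ring homomorphism $f:A\to B$, put $\Gamma_f=B\otimes_{f,A,\eta_L}\Gamma\otimes_{\eta_R,A,f}B$. Then $(B,\Gamma_f)$ is a Hopf algebroid: its left and right units are the inclusions of the first and the third factor; its co-multiplication is $b\otimes\gamma\otimes b'\mapsto\sum(b\otimes\gamma'\otimes1)\otimes(1\otimes\gamma''\otimes b')$, where $\Delta(\gamma)=\sum\gamma'\otimes\gamma''$; its co-unit is $b\otimes\gamma\otimes b'\mapsto b\,f(\epsilon(\gamma))\,b'$; its conjugation is $b\otimes\gamma\otimes b'\mapsto b'\otimes c(\gamma)\otimes b$. There is a morphism of Hopf algebroids $(f,\iota):(A,\Gamma)\to(B,\Gamma_f)$ with $\iota(\gamma)=1\otimes\gamma\otimes1$. **Corollary.** Let $(A,\Gamma)$ be a flat Hopf algebroid and let $f:A\to B$ be a faithfully flat ring homomorphism. Then the functor $$(f,\iota)^*:\mathrm{RCoMod}_\Gamma\to\mathrm{RCoMod}_{\Gamma_f}$$ is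 an equivalence of categories. -/

import Mathlib

open CategoryTheory TensorProduct

universe u

/-- The ring `R`, regarded as an `A`-algebra through the ring homomorphism `φ : A → R`. -/
def Along {A R : Type u} [CommRing A] [CommRing R] (_φ : A →+* R) : Type u := R

namespace Along

variable {A R S : Type u} [CommRing A] [CommRing R] [CommRing S]

instance instCommRing (φ : A →+* R) : CommRing (Along φ) := inferInstanceAs (CommRing R)

/-- The identity of `R`, as a ring isomorphism `R ≃ Along φ`. -/
def of (φ : A →+* R) : R ≃+* Along φ := RingEquiv.refl R

instance instAlgebra (φ : A →+* R) : Algebra A (Along φ) :=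
  ((of φ).toRingHom.comp φ).toAlgebra

theorem algebraMap_apply (φ : A →+* R) (a : A) :
    algebraMap A (Along φ) a = of φ (φ a) := rfl

/-- A ring homomorphism `g : R → S` under `A`, as a homomorphism of `A`-algebras. -/
def algHom (φ : A →+* R) (ψ : A →+* S) (g : R →+* S) (h : g.comp φ = ψ) :
    Along φ →ₐ[A] Along ψ where
  toRingHom := ((of ψ).toRingHom.comp g).comp (of φ).symm.toRingHom
  commutes' a := congrArg (of ψ) (RingHom.congr_fun h a)

end Along

/-- The ring `R ⊗_{φ, A, ψ} S`. -/
def RTensor {A R S : Type u} [CommRing A] [CommRing R] [CommRing S]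
    (φ : A →+* R) (ψ : A →+* S) : Type u := Along φ ⊗[A] Along ψ

namespace RTensor

variable {A R S T : Type u} [CommRing A] [CommRing R] [CommRing S] [CommRing T]

instance instCommRing (φ : A →+* R) (ψ : A →+* S) : CommRing (RTensor φ ψ) :=
  inferInstanceAs (CommRing (Along φ ⊗[A] Along ψ))

/-- The identity of `R ⊗_{φ, A, ψ} S`, as a ring isomorphism to the tensor product of algebras. -/
def equiv (φ : A →+* R) (ψ : A →+* S) : RTensor φ ψ ≃+* Along φ ⊗[A] Along ψ :=
  RingEquiv.refl (Along φ ⊗[A] Along ψ)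

/-- `r ↦ r ⊗ 1`. -/
def inl (φ : A →+* R) (ψ : A →+* S) : R →+* RTensor φ ψ :=
  (equiv φ ψ).symm.toRingHom.comp
    ((Algebra.TensorProduct.includeLeft (R := A) (S := A) (A := Along φ)
      (B := Along ψ)).toRingHom.comp (Along.of φ).toRingHom)

/-- `s ↦ 1 ⊗ s`. -/
def inr (φ : A →+* R) (ψ : A →+* S) : S →+* RTensor φ ψ :=
  (equiv φ ψ).symm.toRingHom.comp
    ((Algebra.TensorProduct.includeRight (R := A) (A := Along φ)
      (B := Along ψ)).toRingHom.comp (Along.of ψ).toRingHom)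

theorem inl_apply (φ : A →+* R) (ψ : A →+* S) (r : R) :
    inl φ ψ r = (equiv φ ψ).symm (Along.of φ r ⊗ₜ[A] (1 : Along ψ)) := rfl

theorem inr_apply (φ : A →+* R) (ψ : A →+* S) (s : S) :
    inr φ ψ s = (equiv φ ψ).symm ((1 : Along φ) ⊗ₜ[A] Along.of ψ s) := rfl

theorem inl_mul_inr (φ : A →+* R) (ψ : A →+* S) (r : R) (s : S) :
    inl φ ψ r * inr φ ψ s = (equiv φ ψ).symm (Along.of φ r ⊗ₜ[A] Along.of ψ s) := by
  rw [inl_apply, inr_apply, ← map_mul, Algebra.TensorProduct.tmul_mul_tmul, mul_one, one_mul]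

theorem condition (φ : A →+* R) (ψ : A →+* S) :
    (inr φ ψ).comp ψ = (inl φ ψ).comp φ := by
  ext a
  have h : algebraMap A (Along φ) a ⊗ₜ[A] (1 : Along ψ)
      = (1 : Along φ) ⊗ₜ[A] algebraMap A (Along ψ) a := by
    rw [Algebra.algebraMap_eq_smul_one, Algebra.algebraMap_eq_smul_one,
      TensorProduct.smul_tmul]
  exact congrArg (equiv φ ψ).symm h.symm

/-- The ring homomorphism `r ⊗ s ↦ f r * g s`. -/
def lift {φ : A →+* R} {ψ : A →+* S} (f : R →+* T) (g : S →+* T)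
    (h : g.comp ψ = f.comp φ) : RTensor φ ψ →+* T :=
  ((Along.of (f.comp φ)).symm.toRingHom.comp
    (Algebra.TensorProduct.productMap (Along.algHom φ (f.comp φ) f rfl)
      (Along.algHom ψ (f.comp φ) g h)).toRingHom).comp (equiv φ ψ).toRingHom

theorem lift_tmul {φ : A →+* R} {ψ : A →+* S} (f : R →+* T) (g : S →+* T)
    (h : g.comp ψ = f.comp φ) (r : R) (s : S) :
    lift f g h ((equiv φ ψ).symm (Along.of φ r ⊗ₜ[A] Along.of ψ s)) = f r * g s := by
  show (Along.of (f.comp φ)).symm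
    (Algebra.TensorProduct.productMap (Along.algHom φ (f.comp φ) f rfl)
      (Along.algHom ψ (f.comp φ) g h) (Along.of φ r ⊗ₜ[A] Along.of ψ s)) = _
  rw [Algebra.TensorProduct.productMap_apply_tmul]
  rfl

@[simp]
theorem lift_inl {φ : A →+* R} {ψ : A →+* S} (f : R →+* T) (g : S →+* T)
    (h : g.comp ψ = f.comp φ) (r : R) : lift f g h (inl φ ψ r) = f r := by
  have := lift_tmul f g h r 1
  rwa [map_one, map_one, mul_one] at this

@[simp]
theorem lift_inr {φ : A →+* R} {ψ : A →+* S} (f : R →+* T) (g : S →+* T)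
    (h : g.comp ψ = f.comp φ) (s : S) : lift f g h (inr φ ψ s) = g s := by
  have := lift_tmul f g h 1 s
  rwa [map_one, map_one, one_mul] at this

@[simp]
theorem lift_comp_inl {φ : A →+* R} {ψ : A →+* S} (f : R →+* T) (g : S →+* T)
    (h : g.comp ψ = f.comp φ) : (lift f g h).comp (inl φ ψ) = f :=
  RingHom.ext (lift_inl f g h)

@[simp]
theorem lift_comp_inr {φ : A →+* R} {ψ : A →+* S} (f : R →+* T) (g : S →+* T)
    (h : g.comp ψ = f.comp φ) : (lift f g h).comp (inr φ ψ) = g :=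
  RingHom.ext (lift_inr f g h)

theorem hom_ext {φ : A →+* R} {ψ : A →+* S} {p q : RTensor φ ψ →+* T}
    (hl : p.comp (inl φ ψ) = q.comp (inl φ ψ))
    (hr : p.comp (inr φ ψ) = q.comp (inr φ ψ)) : p = q := by
  refine RingHom.ext fun x => ?_
  obtain ⟨x, rfl⟩ := (equiv φ ψ).symm.surjective x
  induction x using TensorProduct.induction_on with
  | zero => rw [map_zero, map_zero, map_zero]
  | add x y hx hy => rw [map_add, map_add, map_add, hx, hy]
  | tmul r s =>
    have h := inl_mul_inr φ ψ ((Along.of φ).symm r) ((Along.of ψ).symm s)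
    rw [RingEquiv.apply_symm_apply, RingEquiv.apply_symm_apply] at h
    rw [← h, map_mul, map_mul]
    exact congrArg₂ (· * ·) (RingHom.congr_fun hl _) (RingHom.congr_fun hr _)

end RTensor

/-- The `R`-module `M ⊗_{A, φ} R` obtained from the `A`-module `M` by extension of scalars
along `φ : A → R`. -/
def BaseChange {A R : Type u} [CommRing A] [CommRing R] (φ : A →+* R)
    (M : Type u) [AddCommGroup M] [Module A M] : Type u := M ⊗[A] Along φ

namespace BaseChange

variable {A R T : Type u} [CommRing A] [CommRing R] [CommRing T]
variable {M : Type u} [AddCommGroup M] [Module A M]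
variable {N : Type u} [AddCommGroup N] [Module T N]

instance instAddCommGroup (φ : A →+* R) : AddCommGroup (BaseChange φ M) :=
  inferInstanceAs (AddCommGroup (M ⊗[A] Along φ))

/-- `R` acts by multiplication on the second factor. -/
instance instModule (φ : A →+* R) : Module R (BaseChange φ M) :=
  Module.compHom (M ⊗[A] Along φ)
    (((Module.End.lTensorAlgHom A (Along φ) M).comp
      (Algebra.lmul A (Along φ))).toRingHom.comp (Along.of φ).toRingHom)

/-- The pure tensor `m ⊗ r`. -/
def tmul (φ : A →+* R) (m : M) (r : R) : BaseChange φ M := m ⊗ₜ[A] Along.of φ r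

theorem smul_tmul (φ : A →+* R) (r : R) (m : M) (s : R) :
    r • tmul φ m s = tmul φ m (r * s) := rfl

theorem tmul_eq_smul (φ : A →+* R) (m : M) (r : R) : tmul φ m r = r • tmul φ m 1 := by
  rw [smul_tmul, mul_one]

theorem smul_tmul_eq (φ : A →+* R) (a : A) (m : M) (r : R) :
    tmul φ (a • m) r = tmul φ m (φ a * r) :=
  TensorProduct.smul_tmul a m (Along.of φ r)

theorem add_tmul (φ : A →+* R) (m m' : M) (r : R) :
    tmul φ (m + m') r = tmul φ m r + tmul φ m' r :=
  TensorProduct.add_tmul m m' (Along.of φ r)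

@[elab_as_elim]
theorem induction_on {φ : A →+* R} {p : BaseChange φ M → Prop} (x : BaseChange φ M)
    (zero : p 0) (tmul : ∀ m r, p (tmul φ m r)) (add : ∀ x y, p x → p y → p (x + y)) : p x :=
  TensorProduct.induction_on (motive := p) x zero (fun m r => tmul m r) add

/-- `m ↦ m ⊗ 1`, which is semilinear over `φ`. -/
def incl (φ : A →+* R) (M : Type u) [AddCommGroup M] [Module A M] :
    M →ₛₗ[φ] BaseChange φ M where
  toFun m := tmul φ m 1
  map_add' m m' := add_tmul φ m m' 1
  map_smul' a m := by rw [smul_tmul_eq, smul_tmul]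

theorem incl_apply (φ : A →+* R) (m : M) : incl φ M m = tmul φ m 1 := rfl

/-- The additive map underlying `BaseChange.lift`. -/
def liftAdd {φ : A →+* R} (k : R →+* T) {σ : A →+* T} (h : k.comp φ = σ) (s : M →ₛₗ[σ] N) :
    BaseChange φ M →+ N :=
  TensorProduct.liftAddHom (R := A) (M := M) (N := Along φ)
    { toFun := fun m =>
        { toFun := fun r => k ((Along.of φ).symm r) • s m
          map_zero' := by rw [map_zero, map_zero, zero_smul]
          map_add' := fun r r' => by rw [map_add, map_add, add_smul] }
      map_zero' := by ext r; simp
      map_add' := fun m m' => by ext r; simp }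
    (fun a m r => by
      have e : (Along.of φ).symm (a • r) = φ a * (Along.of φ).symm r := rfl
      have e' : k (φ a) = σ a := RingHom.congr_fun h a
      simp [e, e', mul_smul, smul_comm (σ a)])

theorem liftAdd_tmul {φ : A →+* R} (k : R →+* T) {σ : A →+* T} (h : k.comp φ = σ)
    (s : M →ₛₗ[σ] N) (m : M) (r : R) : liftAdd k h s (tmul φ m r) = k r • s m := rfl

/-- The extension `m ⊗ r ↦ k r • s m` to `M ⊗_{A, φ} R` of a semilinear map `s` on `M`, for
a ring homomorphism `k : R → T` and a `T`-module as target. -/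
def lift {φ : A →+* R} (k : R →+* T) {σ : A →+* T} (h : k.comp φ = σ) (s : M →ₛₗ[σ] N) :
    BaseChange φ M →ₛₗ[k] N where
  toFun := liftAdd k h s
  map_add' := map_add _
  map_smul' r x := by
    induction x using BaseChange.induction_on with
    | zero => rw [smul_zero, map_zero, smul_zero]
    | add x y hx hy => rw [smul_add, map_add, map_add, smul_add, hx, hy]
    | tmul m r' => rw [smul_tmul, liftAdd_tmul, liftAdd_tmul, map_mul, mul_smul]

theorem lift_tmul {φ : A →+* R} (k : R →+* T) {σ : A →+* T} (h : k.comp φ = σ)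
    (s : M →ₛₗ[σ] N) (m : M) (r : R) : lift k h s (tmul φ m r) = k r • s m := rfl

theorem lift_incl {φ : A →+* R} (k : R →+* T) {σ : A →+* T} (h : k.comp φ = σ)
    (s : M →ₛₗ[σ] N) (m : M) : lift k h s (incl φ M m) = s m := by
  rw [incl_apply, lift_tmul, map_one, one_smul]

/-- The composite of a `σ`-semilinear map with a `τ`-semilinear map. -/
def semicomp {A R T : Type u} [CommRing A] [CommRing R] [CommRing T]
    {M N P : Type u} [AddCommGroup M] [AddCommGroup N] [AddCommGroup P]
    [Module A M] [Module R N] [Module T P] {σ : A →+* R} {τ : R →+* T}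
    (t : N →ₛₗ[τ] P) (s : M →ₛₗ[σ] N) : M →ₛₗ[τ.comp σ] P :=
  haveI : RingHomCompTriple σ τ (τ.comp σ) := ⟨rfl⟩
  t.comp s

/-- The map `M ⊗_{A, φ} R → M ⊗_{A, ψ} T`, `m ⊗ r ↦ m ⊗ k r`, for a ring homomorphism
`k : R → T` under `A`. -/
def changeRing {φ : A →+* R} (k : R →+* T) {ψ : A →+* T} (h : k.comp φ = ψ)
    (M : Type u) [AddCommGroup M] [Module A M] :
    BaseChange φ M →ₛₗ[k] BaseChange ψ M :=
  lift k h (incl ψ M)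

theorem changeRing_tmul {φ : A →+* R} (k : R →+* T) {ψ : A →+* T} (h : k.comp φ = ψ)
    (m : M) (r : R) : changeRing k h M (tmul φ m r) = tmul ψ m (k r) := by
  rw [changeRing, lift_tmul, incl_apply, smul_tmul, mul_one]

/-- The `R`-linear map `M ⊗_{A, φ} R → M' ⊗_{A, φ} R`, `m ⊗ r ↦ g m ⊗ r`. -/
def map (φ : A →+* R) {M' : Type u} [AddCommGroup M'] [Module A M'] (g : M →ₗ[A] M') :
    BaseChange φ M →ₗ[R] BaseChange φ M' :=
  lift (RingHom.id R) (σ := φ) (RingHom.id_comp φ) ((incl φ M').comp g)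

theorem map_tmul (φ : A →+* R) {M' : Type u} [AddCommGroup M'] [Module A M']
    (g : M →ₗ[A] M') (m : M) (r : R) : map φ g (tmul φ m r) = tmul φ (g m) r := by
  rw [map, lift_tmul, LinearMap.comp_apply, incl_apply, smul_tmul, mul_one]
  rfl

theorem map_id (φ : A →+* R) : map φ (LinearMap.id : M →ₗ[A] M) = LinearMap.id := by
  ext x
  induction x using BaseChange.induction_on with
  | zero => rw [map_zero, map_zero]
  | add x y hx hy => rw [map_add, map_add, hx, hy]
  | tmul m r => rw [map_tmul]; rfl

theorem map_comp (φ : A →+* R) {M' M'' : Type u} [AddCommGroup M'] [Module A M']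
    [AddCommGroup M''] [Module A M''] (g : M →ₗ[A] M') (g' : M' →ₗ[A] M'') :
    map φ (g'.comp g) = (map φ g').comp (map φ g) := by
  ext x
  induction x using BaseChange.induction_on with
  | zero => rw [map_zero, map_zero]
  | add x y hx hy => rw [map_add, map_add, hx, hy]
  | tmul m r => rw [LinearMap.comp_apply, map_tmul, map_tmul, map_tmul]; rfl

end BaseChange

/-- A Hopf algebroid `(A, Γ)`: ring homomorphisms `η_L, η_R : A → Γ`, `ε : Γ → A`,
`Δ : Γ → Γ ⊗_{η_R, A, η_L} Γ` and `c : Γ → Γ`, subject to the identities saying that, for every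
commutative ring `T`, the sets `Hom(A, T)` of objects and `Hom(Γ, T)` of morphisms form a
groupoid, with source, target, identities, composition and inversion induced by `η_L`, `η_R`,
`ε`, `Δ` and `c`. -/
structure HopfAlgebroid (A Γ : Type u) [CommRing A] [CommRing Γ] where
  /-- The left unit. -/
  etaL : A →+* Γ
  /-- The right unit. -/
  etaR : A →+* Γ
  /-- The co-unit. -/
  eps : Γ →+* A
  /-- The co-multiplication. -/
  comul : Γ →+* RTensor etaR etaL
  /-- The conjugation. -/
  conj : Γ →+* Γ
  eps_etaL : eps.comp etaL = RingHom.id A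
  eps_etaR : eps.comp etaR = RingHom.id A
  comul_etaL : comul.comp etaL = (RTensor.inl etaR etaL).comp etaL
  comul_etaR : comul.comp etaR = (RTensor.inr etaR etaL).comp etaR
  /-- `(ε ⊗ id) ∘ Δ = id`, with `A ⊗_{A, η_L} Γ = Γ`. -/
  counit_left :
    (RTensor.lift (etaL.comp eps) (RingHom.id Γ)
      (by rw [RingHom.comp_assoc, eps_etaR]; rfl)).comp comul = RingHom.id Γ
  /-- `(id ⊗ ε) ∘ Δ = id`, with `Γ ⊗_{η_R, A} A = Γ`. -/
  counit_right :
    (RTensor.lift (RingHom.id Γ) (etaR.comp eps)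
      (by rw [RingHom.comp_assoc, eps_etaL]; rfl)).comp comul = RingHom.id Γ
  /-- `(Δ ⊗ id) ∘ Δ = (id ⊗ Δ) ∘ Δ` in `(Γ ⊗ Γ) ⊗ Γ`, where the factor `Γ ⊗ Γ` is an
  `A`-algebra through the right unit of its second factor. -/
  coassoc :
    (RTensor.lift (φ := etaR) (ψ := etaL)
        ((RTensor.inl ((RTensor.inr etaR etaL).comp etaR) etaL).comp comul)
        (RTensor.inr ((RTensor.inr etaR etaL).comp etaR) etaL)
        (by rw [RTensor.condition, RingHom.comp_assoc, comul_etaR])).comp comul =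
    (RTensor.lift (φ := etaR) (ψ := etaL)
        ((RTensor.inl ((RTensor.inr etaR etaL).comp etaR) etaL).comp (RTensor.inl etaR etaL))
        ((RTensor.lift (φ := etaR) (ψ := etaL)
          ((RTensor.inl ((RTensor.inr etaR etaL).comp etaR) etaL).comp (RTensor.inr etaR etaL))
          (RTensor.inr ((RTensor.inr etaR etaL).comp etaR) etaL)
          (by rw [RTensor.condition, RingHom.comp_assoc])).comp comul)
        (by rw [RingHom.comp_assoc, comul_etaL, ← RingHom.comp_assoc, RTensor.lift_comp_inl,
              RingHom.comp_assoc, RTensor.condition, RingHom.comp_assoc])).comp comul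
  conj_etaL : conj.comp etaL = etaR
  conj_etaR : conj.comp etaR = etaL
  conj_conj : conj.comp conj = RingHom.id Γ
  /-- The product of `c ⊗ id` with `Δ` is `η_R ∘ ε`. -/
  conj_left :
    (RTensor.lift conj (RingHom.id Γ)
      (by rw [conj_etaR]; rfl)).comp comul = etaR.comp eps
  /-- The product of `id ⊗ c` with `Δ` is `η_L ∘ ε`. -/
  conj_right :
    (RTensor.lift (RingHom.id Γ) conj
      (by rw [conj_etaL]; rfl)).comp comul = etaL.comp eps

namespace HopfAlgebroid

variable {A Γ B S : Type u} [CommRing A] [CommRing Γ] [CommRing B] [CommRing S]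

/-- A morphism of Hopf algebroids `(A, Γ) → (B, S)`: a pair of ring homomorphisms compatible with
all the structure maps. -/
structure Hom (H : HopfAlgebroid A Γ) (K : HopfAlgebroid B S) where
  /-- The ring homomorphism on objects. -/
  onObj : A →+* B
  /-- The ring homomorphism on morphisms. -/
  onMor : Γ →+* S
  comp_etaL : onMor.comp H.etaL = K.etaL.comp onObj
  comp_etaR : onMor.comp H.etaR = K.etaR.comp onObj
  comp_eps : K.eps.comp onMor = onObj.comp H.eps
  comp_comul : K.comul.comp onMor =
    (RTensor.lift ((RTensor.inl K.etaR K.etaL).comp onMor) ((RTensor.inr K.etaR K.etaL).comp onMor)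
      (by rw [RingHom.comp_assoc, comp_etaL, ← RingHom.comp_assoc, RTensor.condition,
            RingHom.comp_assoc, ← comp_etaR, RingHom.comp_assoc])).comp H.comul
  comp_conj : K.conj.comp onMor = onMor.comp H.conj

/-! ### The Hopf algebroid `(B, B ⊗_{f, A, η_L} Γ ⊗_{η_R, A, f} B)` -/

/-- The ring `Γ_f = (B ⊗_{f, A, η_L} Γ) ⊗_{η_R, A, f} B`. -/
abbrev BaseChangeRing (H : HopfAlgebroid A Γ) (f : A →+* B) : Type u :=
  RTensor ((RTensor.inr f H.etaL).comp H.etaR) f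

section BaseChangeRing

variable (H : HopfAlgebroid A Γ) (f : A →+* B)

/-- The inclusion `b ↦ b ⊗ 1 ⊗ 1` of the first factor. -/
def in1 : B →+* H.BaseChangeRing f :=
  (RTensor.inl ((RTensor.inr f H.etaL).comp H.etaR) f).comp (RTensor.inl f H.etaL)

/-- The inclusion `γ ↦ 1 ⊗ γ ⊗ 1` of the second factor. -/
def in2 : Γ →+* H.BaseChangeRing f :=
  (RTensor.inl ((RTensor.inr f H.etaL).comp H.etaR) f).comp (RTensor.inr f H.etaL)

/-- The inclusion `b ↦ 1 ⊗ 1 ⊗ b` of the third factor. -/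
def in3 : B →+* H.BaseChangeRing f :=
  RTensor.inr ((RTensor.inr f H.etaL).comp H.etaR) f

theorem in2_etaL : (H.in2 f).comp H.etaL = (H.in1 f).comp f := by
  rw [in1, in2, RingHom.comp_assoc, RTensor.condition, RingHom.comp_assoc]

theorem in3_comp : (H.in3 f).comp f = (H.in2 f).comp H.etaR := by
  rw [in2, in3, RTensor.condition, RingHom.comp_assoc]

variable {H f} {T : Type u} [CommRing T]

/-- The ring homomorphism `b ⊗ γ ⊗ b' ↦ p b * q γ * r b'` out of `Γ_f`. -/
def lift3 (p : B →+* T) (q : Γ →+* T) (r : B →+* T) (h : q.comp H.etaL = p.comp f)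
    (h' : r.comp f = q.comp H.etaR) : H.BaseChangeRing f →+* T :=
  RTensor.lift (RTensor.lift p q h) r
    (by rw [← RingHom.comp_assoc, RTensor.lift_comp_inr, h'])

@[simp]
theorem lift3_in1 (p : B →+* T) (q : Γ →+* T) (r : B →+* T) (h : q.comp H.etaL = p.comp f)
    (h' : r.comp f = q.comp H.etaR) (b : B) : lift3 p q r h h' (H.in1 f b) = p b := by
  simp [lift3, in1]

@[simp]
theorem lift3_in2 (p : B →+* T) (q : Γ →+* T) (r : B →+* T) (h : q.comp H.etaL = p.comp f)
    (h' : r.comp f = q.comp H.etaR) (g : Γ) : lift3 p q r h h' (H.in2 f g) = q g := by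
  simp [lift3, in2]

@[simp]
theorem lift3_in3 (p : B →+* T) (q : Γ →+* T) (r : B →+* T) (h : q.comp H.etaL = p.comp f)
    (h' : r.comp f = q.comp H.etaR) (b : B) : lift3 p q r h h' (H.in3 f b) = r b := by
  simp [lift3, in3]

theorem lift3_comp_in1 (p : B →+* T) (q : Γ →+* T) (r : B →+* T) (h : q.comp H.etaL = p.comp f)
    (h' : r.comp f = q.comp H.etaR) : (lift3 p q r h h').comp (H.in1 f) = p :=
  RingHom.ext (lift3_in1 p q r h h')

theorem lift3_comp_in2 (p : B →+* T) (q : Γ →+* T) (r : B →+* T) (h : q.comp H.etaL = p.comp f)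
    (h' : r.comp f = q.comp H.etaR) : (lift3 p q r h h').comp (H.in2 f) = q :=
  RingHom.ext (lift3_in2 p q r h h')

theorem lift3_comp_in3 (p : B →+* T) (q : Γ →+* T) (r : B →+* T) (h : q.comp H.etaL = p.comp f)
    (h' : r.comp f = q.comp H.etaR) : (lift3 p q r h h').comp (H.in3 f) = r :=
  RingHom.ext (lift3_in3 p q r h h')

theorem hom_ext3 {p q : H.BaseChangeRing f →+* T}
    (h1 : p.comp (H.in1 f) = q.comp (H.in1 f)) (h2 : p.comp (H.in2 f) = q.comp (H.in2 f))
    (h3 : p.comp (H.in3 f) = q.comp (H.in3 f)) : p = q :=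
  RTensor.hom_ext (RTensor.hom_ext h1 h2) h3

end BaseChangeRing


section BaseChangeHopf

variable (H : HopfAlgebroid A Γ) (f : A →+* B)

/-- The co-unit `b ⊗ γ ⊗ b' ↦ b * f (ε γ) * b'` of `Γ_f`. -/
def baseChangeEps : H.BaseChangeRing f →+* B :=
  lift3 (RingHom.id B) (f.comp H.eps) (RingHom.id B)
    (by rw [RingHom.comp_assoc, H.eps_etaL]; rfl)
    (by rw [RingHom.comp_assoc, H.eps_etaR]; rfl)

/-- The ring homomorphism `Γ ⊗_{η_R, A, η_L} Γ → Γ_f ⊗_B Γ_f` that sends `γ ⊗ γ'` to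
`(1 ⊗ γ ⊗ 1) ⊗ (1 ⊗ γ' ⊗ 1)`. -/
def in2Tensor : RTensor H.etaR H.etaL →+* RTensor (H.in3 f) (H.in1 f) :=
  RTensor.lift ((RTensor.inl (H.in3 f) (H.in1 f)).comp (H.in2 f))
    ((RTensor.inr (H.in3 f) (H.in1 f)).comp (H.in2 f))
    (by rw [RingHom.comp_assoc, in2_etaL, ← RingHom.comp_assoc, RTensor.condition,
          RingHom.comp_assoc, in3_comp, RingHom.comp_assoc])

/-- The co-multiplication of `Γ_f`, which sends `b ⊗ γ ⊗ b'` to the sum of the elements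
`(b ⊗ γ' ⊗ 1) ⊗ (1 ⊗ γ'' ⊗ b')`, where `Δ γ` is the sum of the elements `γ' ⊗ γ''`. -/
def baseChangeComul : H.BaseChangeRing f →+* RTensor (H.in3 f) (H.in1 f) :=
  lift3 ((RTensor.inl (H.in3 f) (H.in1 f)).comp (H.in1 f))
    ((H.in2Tensor f).comp H.comul)
    ((RTensor.inr (H.in3 f) (H.in1 f)).comp (H.in3 f))
    (by rw [RingHom.comp_assoc, H.comul_etaL, ← RingHom.comp_assoc, in2Tensor,
          RTensor.lift_comp_inl, RingHom.comp_assoc, in2_etaL, RingHom.comp_assoc])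
    (by rw [RingHom.comp_assoc, RingHom.comp_assoc, H.comul_etaR, in3_comp,
          ← RingHom.comp_assoc, ← RingHom.comp_assoc, in2Tensor, RTensor.lift_comp_inr])

/-- The conjugation `b ⊗ γ ⊗ b' ↦ b' ⊗ c γ ⊗ b` of `Γ_f`. -/
def baseChangeConj : H.BaseChangeRing f →+* H.BaseChangeRing f :=
  lift3 (H.in3 f) ((H.in2 f).comp H.conj) (H.in1 f)
    (by rw [RingHom.comp_assoc, H.conj_etaL, in3_comp])
    (by rw [RingHom.comp_assoc, H.conj_etaR, in2_etaL])

@[simp]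
theorem baseChangeEps_in1 (b : B) : H.baseChangeEps f (H.in1 f b) = b := lift3_in1 _ _ _ _ _ b

@[simp]
theorem baseChangeEps_in2 (g : Γ) : H.baseChangeEps f (H.in2 f g) = f (H.eps g) :=
  lift3_in2 _ _ _ _ _ g

@[simp]
theorem baseChangeEps_in3 (b : B) : H.baseChangeEps f (H.in3 f b) = b := lift3_in3 _ _ _ _ _ b

@[simp]
theorem baseChangeConj_in1 (b : B) : H.baseChangeConj f (H.in1 f b) = H.in3 f b :=
  lift3_in1 _ _ _ _ _ b

@[simp]
theorem baseChangeConj_in2 (g : Γ) : H.baseChangeConj f (H.in2 f g) = H.in2 f (H.conj g) :=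
  lift3_in2 _ _ _ _ _ g

@[simp]
theorem baseChangeConj_in3 (b : B) : H.baseChangeConj f (H.in3 f b) = H.in1 f b :=
  lift3_in3 _ _ _ _ _ b

@[simp]
theorem baseChangeComul_in1 (b : B) :
    H.baseChangeComul f (H.in1 f b) = RTensor.inl (H.in3 f) (H.in1 f) (H.in1 f b) :=
  lift3_in1 _ _ _ _ _ b

@[simp]
theorem baseChangeComul_in2 (g : Γ) :
    H.baseChangeComul f (H.in2 f g) = H.in2Tensor f (H.comul g) :=
  lift3_in2 _ _ _ _ _ g

@[simp]
theorem baseChangeComul_in3 (b : B) :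
    H.baseChangeComul f (H.in3 f b) = RTensor.inr (H.in3 f) (H.in1 f) (H.in3 f b) :=
  lift3_in3 _ _ _ _ _ b

@[simp]
theorem in2Tensor_inl (g : Γ) :
    H.in2Tensor f (RTensor.inl H.etaR H.etaL g) = RTensor.inl (H.in3 f) (H.in1 f) (H.in2 f g) :=
  RTensor.lift_inl _ _ _ g

@[simp]
theorem in2Tensor_inr (g : Γ) :
    H.in2Tensor f (RTensor.inr H.etaR H.etaL g) = RTensor.inr (H.in3 f) (H.in1 f) (H.in2 f g) :=
  RTensor.lift_inr _ _ _ g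

theorem in2_etaL_apply (a : A) : H.in2 f (H.etaL a) = H.in1 f (f a) :=
  RingHom.congr_fun (H.in2_etaL f) a

theorem in3_apply (a : A) : H.in3 f (f a) = H.in2 f (H.etaR a) :=
  RingHom.congr_fun (H.in3_comp f) a

/-- A ring homomorphism `p` out of `Γ_f ⊗_B Γ_f` and a ring homomorphism `q` out of `Γ ⊗_A Γ` that
correspond to each other under a ring homomorphism `k` agree on `Δ γ`. -/
theorem apply_in2Tensor {T T' : Type u} [CommRing T] [CommRing T']
    (p : RTensor (H.in3 f) (H.in1 f) →+* T) (q : RTensor H.etaR H.etaL →+* T') (k : T' →+* T)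
    (hl : ∀ g, p (RTensor.inl _ _ (H.in2 f g)) = k (q (RTensor.inl _ _ g)))
    (hr : ∀ g, p (RTensor.inr _ _ (H.in2 f g)) = k (q (RTensor.inr _ _ g)))
    (x : RTensor H.etaR H.etaL) : p (H.in2Tensor f x) = k (q x) := by
  have : p.comp (H.in2Tensor f) = k.comp q := by
    apply RTensor.hom_ext
    · refine RingHom.ext fun g => ?_
      rw [RingHom.comp_apply, RingHom.comp_apply, in2Tensor_inl, hl]; rfl
    · refine RingHom.ext fun g => ?_
      rw [RingHom.comp_apply, RingHom.comp_apply, in2Tensor_inr, hr]; rfl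
  exact RingHom.congr_fun this x

/-- The Hopf algebroid `(B, Γ_f)` with `Γ_f = B ⊗_{f, A, η_L} Γ ⊗_{η_R, A, f} B`; its left and
right units are the inclusions of the first and of the third factor. -/
def baseChange : HopfAlgebroid B (H.BaseChangeRing f) where
  etaL := H.in1 f
  etaR := H.in3 f
  eps := H.baseChangeEps f
  comul := H.baseChangeComul f
  conj := H.baseChangeConj f
  eps_etaL := RingHom.ext (H.baseChangeEps_in1 f)
  eps_etaR := RingHom.ext (H.baseChangeEps_in3 f)
  comul_etaL := RingHom.ext (H.baseChangeComul_in1 f)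
  comul_etaR := RingHom.ext (H.baseChangeComul_in3 f)
  counit_left := by
    apply hom_ext3
    · refine RingHom.ext fun b => ?_
      simp
    · refine RingHom.ext fun g => ?_
      have h := RingHom.congr_fun H.counit_left g
      simp only [RingHom.comp_apply, RingHom.id_apply, baseChangeComul_in2] at h ⊢
      rw [apply_in2Tensor H f _ (RTensor.lift (H.etaL.comp H.eps) (RingHom.id Γ)
        (by rw [RingHom.comp_assoc, H.eps_etaR]; rfl)) (H.in2 f), h]
      · intro g; simp [in2_etaL_apply]
      · intro g; simp
    · refine RingHom.ext fun b => ?_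
      simp
  counit_right := by
    apply hom_ext3
    · refine RingHom.ext fun b => ?_
      simp
    · refine RingHom.ext fun g => ?_
      have h := RingHom.congr_fun H.counit_right g
      simp only [RingHom.comp_apply, RingHom.id_apply, baseChangeComul_in2] at h ⊢
      rw [apply_in2Tensor H f _ (RTensor.lift (RingHom.id Γ) (H.etaR.comp H.eps)
        (by rw [RingHom.comp_assoc, H.eps_etaL]; rfl)) (H.in2 f), h]
      · intro g; simp
      · intro g; simp [in3_apply]
    · refine RingHom.ext fun b => ?_
      simp
  coassoc := by
    apply hom_ext3
    · refine RingHom.ext fun b => ?_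
      simp
    · refine RingHom.ext fun g => ?_
      have h := RingHom.congr_fun H.coassoc g
      simp only [RingHom.comp_apply, baseChangeComul_in2] at h ⊢
      let k : RTensor ((RTensor.inr H.etaR H.etaL).comp H.etaR) H.etaL →+*
          RTensor ((RTensor.inr (H.in3 f) (H.in1 f)).comp (H.in3 f)) (H.in1 f) :=
        RTensor.lift ((RTensor.inl _ _).comp (H.in2Tensor f)) ((RTensor.inr _ _).comp (H.in2 f))
          (by
            refine RingHom.ext fun a => ?_
            have := RingHom.congr_fun (RTensor.condition
              ((RTensor.inr (H.in3 f) (H.in1 f)).comp (H.in3 f)) (H.in1 f)) (f a)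
            simpa [in2_etaL_apply, in3_apply] using this)
      refine (apply_in2Tensor H f _ _ k ?_ ?_ _).trans ((congrArg k h).trans
        (apply_in2Tensor H f _ _ k ?_ ?_ _).symm)
      · intro g; simp [k]
      · intro g; simp [k]
      · intro g; simp [k]
      · intro g
        simp only [RTensor.lift_inr, RingHom.comp_apply, baseChangeComul_in2]
        apply apply_in2Tensor
        · intro g; simp [k]
        · intro g; simp [k]
    · refine RingHom.ext fun b => ?_
      simp
  conj_etaL := RingHom.ext (H.baseChangeConj_in1 f)
  conj_etaR := RingHom.ext (H.baseChangeConj_in3 f)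
  conj_conj := by
    apply hom_ext3
    · refine RingHom.ext fun b => ?_
      simp
    · refine RingHom.ext fun g => ?_
      have h : H.conj (H.conj g) = g := RingHom.congr_fun H.conj_conj g
      simp [h]
    · refine RingHom.ext fun b => ?_
      simp
  conj_left := by
    apply hom_ext3
    · refine RingHom.ext fun b => ?_
      simp
    · refine RingHom.ext fun g => ?_
      have h := RingHom.congr_fun H.conj_left g
      simp only [RingHom.comp_apply, baseChangeComul_in2, baseChangeEps_in2] at h ⊢
      rw [apply_in2Tensor H f _ (RTensor.lift H.conj (RingHom.id Γ)
        (by rw [H.conj_etaR]; rfl)) (H.in2 f), h, in3_apply]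
      · intro g; simp
      · intro g; simp
    · refine RingHom.ext fun b => ?_
      simp
  conj_right := by
    apply hom_ext3
    · refine RingHom.ext fun b => ?_
      simp
    · refine RingHom.ext fun g => ?_
      have h := RingHom.congr_fun H.conj_right g
      simp only [RingHom.comp_apply, baseChangeComul_in2, baseChangeEps_in2] at h ⊢
      rw [apply_in2Tensor H f _ (RTensor.lift (RingHom.id Γ) H.conj
        (by rw [H.conj_etaL]; rfl)) (H.in2 f), h, in2_etaL_apply]
      · intro g; simp
      · intro g; simp
    · refine RingHom.ext fun b => ?_
      simp

/-- The natural morphism `(f, ι) : (A, Γ) → (B, Γ_f)`, where `ι γ = 1 ⊗ γ ⊗ 1`. -/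
def toBaseChange : Hom H (H.baseChange f) where
  onObj := f
  onMor := H.in2 f
  comp_etaL := H.in2_etaL f
  comp_etaR := (H.in3_comp f).symm
  comp_eps := RingHom.ext (H.baseChangeEps_in2 f)
  comp_comul := RingHom.ext (H.baseChangeComul_in2 f)
  comp_conj := RingHom.ext (H.baseChangeConj_in2 f)

end BaseChangeHopf

/-! ### Comodules -/

section Comodule

variable (H : HopfAlgebroid A Γ)

/-- The `A`-algebra structure on `Γ ⊗_{η_R, A, η_L} Γ` given by the left unit of the first
factor. -/
def etaLL : A →+* RTensor H.etaR H.etaL := (RTensor.inl H.etaR H.etaL).comp H.etaL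

variable (M : Type u) [AddCommGroup M] [Module A M]

/-- `id_M ⊗ ε : M ⊗_{A, η_L} Γ → M`. -/
def idEps : BaseChange H.etaL M →ₛₗ[H.eps] M :=
  BaseChange.lift H.eps (σ := RingHom.id A) H.eps_etaL LinearMap.id

/-- `id_M ⊗ Δ : M ⊗_{A, η_L} Γ → M ⊗_{A, η_L} (Γ ⊗_{η_R, A, η_L} Γ)`. -/
def idComul : BaseChange H.etaL M →ₛₗ[H.comul] BaseChange H.etaLL M :=
  BaseChange.changeRing H.comul H.comul_etaL M

/-- `M ⊗_{A, η_L} Γ → M ⊗_{A, η_L} (Γ ⊗_{η_R, A, η_L} Γ)`, `m ⊗ γ ↦ m ⊗ (γ ⊗ 1)`. -/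
def idInl : BaseChange H.etaL M →ₛₗ[RTensor.inl H.etaR H.etaL] BaseChange H.etaLL M :=
  BaseChange.changeRing (RTensor.inl H.etaR H.etaL) rfl M

theorem idComul_tmul (m : M) (g : Γ) :
    H.idComul M (BaseChange.tmul H.etaL m g) = BaseChange.tmul H.etaLL m (H.comul g) :=
  BaseChange.changeRing_tmul ..

theorem idInl_tmul (m : M) (g : Γ) :
    H.idInl M (BaseChange.tmul H.etaL m g) =
      BaseChange.tmul H.etaLL m (RTensor.inl H.etaR H.etaL g) :=
  BaseChange.changeRing_tmul ..

variable {M}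

/-- `ψ ⊗ id_Γ : M ⊗_{A, η_L} Γ → (M ⊗_{A, η_L} Γ) ⊗_{η_R, A, η_L} Γ`, the target being identified
with `M ⊗_{A, η_L} (Γ ⊗_{η_R, A, η_L} Γ)`: if `ψ m` is the sum of the elements `m' ⊗ γ'`, then
`m ⊗ γ` is sent to the sum of the elements `m' ⊗ (γ' ⊗ γ)`. -/
def coactId (ψ : M →ₛₗ[H.etaR] BaseChange H.etaL M) :
    BaseChange H.etaL M →ₛₗ[RTensor.inr H.etaR H.etaL] BaseChange H.etaLL M :=
  BaseChange.lift (RTensor.inr H.etaR H.etaL) (RTensor.condition H.etaR H.etaL)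
    (BaseChange.semicomp (H.idInl M) ψ)

end Comodule

/-- A right comodule over a Hopf algebroid `(A, Γ)`: an `A`-module `M` with a structure map
`ψ : M → M ⊗_{A, η_L} Γ` that is `A`-linear for the `A`-module structure of the target given by
`η_R : A → Γ`, and that is co-unitary and co-associative. -/
structure RCoMod (H : HopfAlgebroid A Γ) : Type (u + 1) where
  /-- The underlying module. -/
  carrier : Type u
  [addCommGroup : AddCommGroup carrier]
  [module : Module A carrier]
  /-- The structure map. -/
  coact : carrier →ₛₗ[H.etaR] BaseChange H.etaL carrier
  /-- `(id ⊗ ε) ∘ ψ = id`. -/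
  counit : ∀ m, H.idEps carrier (coact m) = m
  /-- `(id ⊗ Δ) ∘ ψ = (ψ ⊗ id) ∘ ψ`. -/
  coassoc : ∀ m, H.idComul carrier (coact m) = H.coactId coact (coact m)

namespace RCoMod

attribute [instance] addCommGroup module

/-- A morphism of comodules: an `A`-linear map compatible with the structure maps. -/
@[ext]
structure Hom {H : HopfAlgebroid A Γ} (M N : RCoMod H) where
  /-- The underlying linear map. -/
  toLin : M.carrier →ₗ[A] N.carrier
  comm : ∀ m, N.coact (toLin m) = BaseChange.map H.etaL toLin (M.coact m)

instance instCategory (H : HopfAlgebroid A Γ) : Category.{u} (RCoMod H) where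
  Hom M N := Hom M N
  id M :=
    { toLin := LinearMap.id
      comm := fun m => by
        rw [BaseChange.map_id]; rfl }
  comp F G :=
    { toLin := G.toLin.comp F.toLin
      comm := fun m => by
        rw [BaseChange.map_comp, LinearMap.comp_apply, G.comm, F.comm]; rfl }

@[ext]
theorem hom_ext {H : HopfAlgebroid A Γ} {M N : RCoMod H} {F G : M ⟶ N}
    (h : F.toLin = G.toLin) : F = G := Hom.ext h

end RCoMod

/-! ### Functoriality -/

namespace Hom

variable {H : HopfAlgebroid A Γ} {K : HopfAlgebroid B S} (F : Hom H K)

/-- The map `M ⊗_{A, η_L} Γ → (M ⊗_A B) ⊗_{B, η_L} S`, `m ⊗ γ ↦ (m ⊗ 1) ⊗ g γ`, where `g : Γ → S`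
is the component of the morphism on morphisms: the composite of `id_M ⊗ g` with the
identification `M ⊗_{A, η_L} S = (M ⊗_A B) ⊗_{B, η_L} S`. -/
def transfer (M : Type u) [AddCommGroup M] [Module A M] :
    BaseChange H.etaL M →ₛₗ[F.onMor] BaseChange K.etaL (BaseChange F.onObj M) :=
  BaseChange.lift F.onMor F.comp_etaL
    (BaseChange.semicomp (BaseChange.incl K.etaL (BaseChange F.onObj M))
      (BaseChange.incl F.onObj M))

/-- The structure map `M ⊗_A B → (M ⊗_A B) ⊗_{B, η_L} S` induced by the composite of the
structure map of `M` with `transfer`. -/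
def pullbackCoact (M : RCoMod H) :
    BaseChange F.onObj M.carrier →ₛₗ[K.etaR] BaseChange K.etaL (BaseChange F.onObj M.carrier) :=
  BaseChange.lift K.etaR F.comp_etaR.symm (BaseChange.semicomp (F.transfer M.carrier) M.coact)

theorem pullbackCoact_incl (M : RCoMod H) (m : M.carrier) :
    F.pullbackCoact M (BaseChange.incl F.onObj M.carrier m) =
      F.transfer M.carrier (M.coact m) :=
  BaseChange.lift_incl ..

theorem transfer_tmul (M : Type u) [AddCommGroup M] [Module A M] (m : M) (g : Γ) :
    F.transfer M (BaseChange.tmul H.etaL m g) =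
      BaseChange.tmul K.etaL (BaseChange.incl F.onObj M m) (F.onMor g) := by
  rw [BaseChange.tmul_eq_smul K.etaL]
  rfl

theorem pullback_counit (M : RCoMod H) (x : BaseChange F.onObj M.carrier) :
    K.idEps (BaseChange F.onObj M.carrier) (F.pullbackCoact M x) = x := by
  have key : ∀ y : BaseChange H.etaL M.carrier,
      K.idEps (BaseChange F.onObj M.carrier) (F.transfer M.carrier y) =
        BaseChange.incl F.onObj M.carrier (H.idEps M.carrier y) := by
    intro y
    induction y using BaseChange.induction_on with
    | zero => simp only [map_zero]
    | add x y hx hy => simp only [map_add, hx, hy]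
    | tmul m g =>
      have e : K.eps (F.onMor g) = F.onObj (H.eps g) := RingHom.congr_fun F.comp_eps g
      rw [transfer_tmul, idEps, idEps, BaseChange.lift_tmul, BaseChange.lift_tmul, e]
      exact ((BaseChange.incl F.onObj M.carrier).map_smulₛₗ (H.eps g) m).symm
  induction x using BaseChange.induction_on with
  | zero => simp only [map_zero]
  | add x y hx hy => simp only [map_add, hx, hy]
  | tmul m b =>
    have e : K.eps (K.etaR b) = b := RingHom.congr_fun K.eps_etaR b
    rw [BaseChange.tmul_eq_smul, ← BaseChange.incl_apply, LinearMap.map_smulₛₗ,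
      LinearMap.map_smulₛₗ, e, pullbackCoact_incl, key, M.counit]

/-- The ring homomorphism `g ⊗ g : Γ ⊗_A Γ → S ⊗_B S`. -/
def onMor2 : RTensor H.etaR H.etaL →+* RTensor K.etaR K.etaL :=
  RTensor.lift ((RTensor.inl K.etaR K.etaL).comp F.onMor)
    ((RTensor.inr K.etaR K.etaL).comp F.onMor)
    (by rw [RingHom.comp_assoc, F.comp_etaL, ← RingHom.comp_assoc, RTensor.condition,
            RingHom.comp_assoc, ← F.comp_etaR, RingHom.comp_assoc])

/-- The analogue of `transfer` for `Γ ⊗_A Γ` and `S ⊗_B S`. -/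
def transfer2 (M : Type u) [AddCommGroup M] [Module A M] :
    BaseChange H.etaLL M →ₛₗ[F.onMor2] BaseChange K.etaLL (BaseChange F.onObj M) :=
  BaseChange.lift F.onMor2
    (show F.onMor2.comp H.etaLL = K.etaLL.comp F.onObj by
      rw [etaLL, etaLL, onMor2, ← RingHom.comp_assoc, RTensor.lift_comp_inl, RingHom.comp_assoc,
        F.comp_etaL, RingHom.comp_assoc])
    (BaseChange.semicomp (BaseChange.incl K.etaLL (BaseChange F.onObj M))
      (BaseChange.incl F.onObj M))

theorem transfer2_tmul (M : Type u) [AddCommGroup M] [Module A M] (m : M)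
    (g : RTensor H.etaR H.etaL) :
    F.transfer2 M (BaseChange.tmul H.etaLL m g) =
      BaseChange.tmul K.etaLL (BaseChange.incl F.onObj M m) (F.onMor2 g) := by
  rw [BaseChange.tmul_eq_smul K.etaLL]
  rfl

theorem pullback_coassoc (M : RCoMod H) (x : BaseChange F.onObj M.carrier) :
    K.idComul (BaseChange F.onObj M.carrier) (F.pullbackCoact M x) =
      K.coactId (F.pullbackCoact M) (F.pullbackCoact M x) := by
  have k1 : ∀ y : BaseChange H.etaL M.carrier,
      K.idComul (BaseChange F.onObj M.carrier) (F.transfer M.carrier y) =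
        F.transfer2 M.carrier (H.idComul M.carrier y) := by
    intro y
    induction y using BaseChange.induction_on with
    | zero => simp only [map_zero]
    | add x y hx hy => simp only [map_add, hx, hy]
    | tmul m g =>
      have e : K.comul (F.onMor g) = F.onMor2 (H.comul g) := RingHom.congr_fun F.comp_comul g
      rw [transfer_tmul, idComul_tmul, idComul_tmul, transfer2_tmul, e]
  have k2 : ∀ y : BaseChange H.etaL M.carrier,
      K.idInl (BaseChange F.onObj M.carrier) (F.transfer M.carrier y) =
        F.transfer2 M.carrier (H.idInl M.carrier y) := by
    intro y
    induction y using BaseChange.induction_on with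
    | zero => simp only [map_zero]
    | add x y hx hy => simp only [map_add, hx, hy]
    | tmul m g =>
      have e : F.onMor2 (RTensor.inl _ _ g) = RTensor.inl _ _ (F.onMor g) :=
        RTensor.lift_inl _ _ _ g
      rw [transfer_tmul, idInl_tmul, idInl_tmul, transfer2_tmul, e]
  have k3 : ∀ y : BaseChange H.etaL M.carrier,
      K.coactId (F.pullbackCoact M) (F.transfer M.carrier y) =
        F.transfer2 M.carrier (H.coactId M.coact y) := by
    intro y
    induction y using BaseChange.induction_on with
    | zero => simp only [map_zero]
    | add x y hx hy => simp only [map_add, hx, hy]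
    | tmul m g =>
      have e : F.onMor2 (RTensor.inr _ _ g) = RTensor.inr _ _ (F.onMor g) :=
        RTensor.lift_inr _ _ _ g
      rw [transfer_tmul, coactId, coactId, BaseChange.lift_tmul, BaseChange.lift_tmul,
        LinearMap.map_smulₛₗ, e]
      refine congrArg _ ?_
      refine Eq.trans ?_ (k2 (M.coact m))
      exact congrArg _ (F.pullbackCoact_incl M m)
  induction x using BaseChange.induction_on with
  | zero => simp only [map_zero]
  | add x y hx hy => simp only [map_add, hx, hy]
  | tmul m b =>
    have e : K.comul (K.etaR b) = RTensor.inr _ _ (K.etaR b) := RingHom.congr_fun K.comul_etaR b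
    rw [BaseChange.tmul_eq_smul, ← BaseChange.incl_apply, LinearMap.map_smulₛₗ,
      LinearMap.map_smulₛₗ, LinearMap.map_smulₛₗ, e, pullbackCoact_incl, k1, k3, M.coassoc]

theorem pullback_comm {M N : RCoMod H} (u : M ⟶ N) (x : BaseChange F.onObj M.carrier) :
    F.pullbackCoact N (BaseChange.map F.onObj u.toLin x) =
      BaseChange.map K.etaL (BaseChange.map F.onObj u.toLin) (F.pullbackCoact M x) := by
  have key : ∀ y : BaseChange H.etaL M.carrier,
      F.transfer N.carrier (BaseChange.map H.etaL u.toLin y) =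
        BaseChange.map K.etaL (BaseChange.map F.onObj u.toLin) (F.transfer M.carrier y) := by
    intro y
    induction y using BaseChange.induction_on with
    | zero => simp only [map_zero]
    | add x y hx hy => simp only [map_add, hx, hy]
    | tmul m g =>
      rw [transfer_tmul, BaseChange.map_tmul, BaseChange.map_tmul, transfer_tmul,
        BaseChange.incl_apply, BaseChange.incl_apply, BaseChange.map_tmul]
  induction x using BaseChange.induction_on with
  | zero => simp only [map_zero]
  | add x y hx hy => simp only [map_add, hx, hy]
  | tmul m b =>
    rw [BaseChange.map_tmul, BaseChange.tmul_eq_smul, BaseChange.tmul_eq_smul _ m,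
      ← BaseChange.incl_apply, ← BaseChange.incl_apply, LinearMap.map_smulₛₗ,
      LinearMap.map_smulₛₗ, LinearMap.map_smul, pullbackCoact_incl, pullbackCoact_incl,
      ← key, u.comm]

/-- The functor `F^* : RCoMod_Γ → RCoMod_S`, `M ↦ M ⊗_A B`, induced by a morphism
`F : (A, Γ) → (B, S)` of Hopf algebroids. -/
def pullback : RCoMod H ⥤ RCoMod K where
  obj M :=
    { carrier := BaseChange F.onObj M.carrier
      coact := F.pullbackCoact M
      counit := F.pullback_counit M
      coassoc := F.pullback_coassoc M }
  map u :=
    { toLin := BaseChange.map F.onObj u.toLin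
      comm := F.pullback_comm u }
  map_id _ := RCoMod.hom_ext (BaseChange.map_id ..)
  map_comp _ _ := RCoMod.hom_ext (BaseChange.map_comp ..)

end Hom

end HopfAlgebroid

namespace Along

variable {A R : Type u} [CommRing A] [CommRing R]

theorem flat {φ : A →+* R} (h : φ.Flat) : Module.Flat A (Along φ) :=
  RingHom.flat_algebraMap_iff.1 (show (algebraMap A (Along φ)).Flat from h)

theorem faithfullyFlat {φ : A →+* R} (h : φ.FaithfullyFlat) :
    Module.FaithfullyFlat A (Along φ) :=
  RingHom.faithfullyFlat_algebraMap_iff.1 (show (algebraMap A (Along φ)).FaithfullyFlat from h)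

end Along

namespace RTensor

variable {A R S : Type u} [CommRing A] [CommRing R] [CommRing S]

theorem inl_faithfullyFlat (φ : A →+* R) {ψ : A →+* S} (h : ψ.FaithfullyFlat) :
    (inl φ ψ).FaithfullyFlat := by
  have := Along.faithfullyFlat h
  have : Module.FaithfullyFlat (Along φ) (Along φ ⊗[A] Along ψ) := inferInstance
  exact (RingHom.faithfullyFlat_algebraMap_iff
    (R := Along φ) (S := Along φ ⊗[A] Along ψ)).2 this

@[elab_as_elim]
theorem induction_on {φ : A →+* R} {ψ : A →+* S} {p : RTensor φ ψ → Prop} (x : RTensor φ ψ)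
    (zero : p 0) (mul : ∀ r s, p (inl φ ψ r * inr φ ψ s))
    (add : ∀ x y, p x → p y → p (x + y)) : p x :=
  TensorProduct.induction_on (motive := p) x zero
    (fun r s => (congrArg p (inl_mul_inr φ ψ ((Along.of φ).symm r) ((Along.of ψ).symm s))).mp
      (mul ((Along.of φ).symm r) ((Along.of ψ).symm s))) add

/-- The ring isomorphism `r ⊗ s ↦ s ⊗ r`. -/
def swap (φ : A →+* R) (ψ : A →+* S) : RTensor φ ψ ≃+* RTensor ψ φ :=
  RingEquiv.ofRingHom
    (lift (inr ψ φ) (inl ψ φ) (condition ψ φ).symm)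
    (lift (inr φ ψ) (inl φ ψ) (condition φ ψ).symm)
    (hom_ext (by ext; simp) (by ext; simp))
    (hom_ext (by ext; simp) (by ext; simp))

theorem inr_faithfullyFlat {φ : A →+* R} (ψ : A →+* S) (h : φ.FaithfullyFlat) :
    (inr φ ψ).FaithfullyFlat := by
  have : inr φ ψ = (swap ψ φ).toRingHom.comp (inl ψ φ) :=
    RingHom.ext fun s => (lift_inl (inr φ ψ) (inl φ ψ) _ s).symm
  rw [this]
  exact RingHom.FaithfullyFlat.stableUnderComposition _ _ (inl_faithfullyFlat ψ h)
    (RingHom.FaithfullyFlat.of_bijective (swap ψ φ).bijective)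

end RTensor

/-- The `A`-module obtained from the `B`-module `N` by restriction of scalars along
`φ : A → B`. -/
def Restrict {A B : Type u} [CommRing A] [CommRing B] (_φ : A →+* B) (N : Type u) : Type u := N

namespace Restrict

variable {A B : Type u} [CommRing A] [CommRing B] (φ : A →+* B)
variable (N : Type u) [AddCommGroup N] [Module B N]

instance instAddCommGroup : AddCommGroup (Restrict φ N) := inferInstanceAs (AddCommGroup N)

instance instModule : Module A (Restrict φ N) := Module.compHom N φ

/-- The identity of `N`, which is semilinear over `φ`. -/
def out : Restrict φ N →ₛₗ[φ] N where
  toFun n := n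
  map_add' _ _ := rfl
  map_smul' _ _ := rfl

/-- The identity of `N`. -/
def into : N ≃+ Restrict φ N := AddEquiv.refl N

variable {φ N}

/-- A semilinear map, with both sides restricted to scalars in `A`. -/
def map {T P : Type u} [CommRing T] [AddCommGroup P] [Module T P] {σ : B →+* T} {l : A →+* T}
    (h : σ.comp φ = l) (s : N →ₛₗ[σ] P) : Restrict φ N →ₗ[A] Restrict l P where
  toFun n := into l P (s (out φ N n))
  map_add' n n' := s.map_add n n'
  map_smul' a n := by
    subst h
    exact s.map_smulₛₗ (φ a) n

/-- A semilinear map, as a linear map to the restriction of scalars. -/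
def lin {M : Type u} [AddCommGroup M] [Module A M] (s : M →ₛₗ[φ] N) : M →ₗ[A] Restrict φ N where
  toFun := s
  map_add' := s.map_add
  map_smul' := s.map_smulₛₗ

end Restrict

namespace BaseChange

variable {A B R T T' : Type u} [CommRing A] [CommRing B] [CommRing R] [CommRing T] [CommRing T']
variable {M : Type u} [AddCommGroup M] [Module A M]
variable {N : Type u} [AddCommGroup N] [Module B N]

/-- Semilinear maps out of `M ⊗_{A, φ} R` agree if they agree on the elements `m ⊗ 1`. -/
theorem semi_ext {φ : A →+* R} {k : R →+* T} {P : Type u} [AddCommGroup P] [Module T P]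
    {s t : BaseChange φ M →ₛₗ[k] P} (h : ∀ m, s (tmul φ m 1) = t (tmul φ m 1))
    (x : BaseChange φ M) : s x = t x := by
  induction x using BaseChange.induction_on with
  | zero => rw [map_zero, map_zero]
  | add x y hx hy => rw [map_add, map_add, hx, hy]
  | tmul m r => rw [tmul_eq_smul, LinearMap.map_smulₛₗ, LinearMap.map_smulₛₗ, h]

theorem tmul_zero (φ : A →+* R) (m : M) : tmul φ m 0 = 0 := by
  rw [tmul_eq_smul, zero_smul]

theorem tmul_add (φ : A →+* R) (m : M) (r s : R) :
    tmul φ m (r + s) = tmul φ m r + tmul φ m s := by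
  rw [tmul_eq_smul, add_smul, ← tmul_eq_smul, ← tmul_eq_smul]

theorem map_eq_rTensor (φ : A →+* R) {M' : Type u} [AddCommGroup M'] [Module A M']
    (g : M →ₗ[A] M') (x : BaseChange φ M) :
    map φ g x = g.rTensor (Along φ) (show M ⊗[A] Along φ from x) := by
  induction x using BaseChange.induction_on with
  | zero => rw [_root_.map_zero]; exact (_root_.map_zero (g.rTensor (Along φ))).symm
  | add x y hx hy =>
    rw [_root_.map_add, hx, hy]; exact (_root_.map_add (g.rTensor (Along φ)) _ _).symm
  | tmul m r => rw [map_tmul]; rfl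

theorem incl_injective {φ : A →+* R} (h : φ.FaithfullyFlat) :
    Function.Injective (incl φ M) := by
  have := Along.faithfullyFlat h
  intro x y hxy
  have key := Module.FaithfullyFlat.tensorProduct_mk_injective (A := A) (B := Along φ) M
  apply key
  have := congrArg (TensorProduct.comm A M (Along φ)) hxy
  exact this

/-- The map `M ⊗_{A, l} T → N ⊗_{B, p} T` induced by a semilinear map `i : M → N`
over `φ : A → B`, where `l = p ∘ φ`. -/
def ext {φ : A →+* B} (i : M →ₛₗ[φ] N) (p : B →+* T) {l : A →+* T} (h : p.comp φ = l) :
    BaseChange l M →ₗ[T] BaseChange p N :=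
  haveI : RingHomCompTriple φ p l := ⟨h⟩
  lift (RingHom.id T) (RingHom.id_comp l) ((incl p N).comp i)

@[simp]
theorem ext_tmul {φ : A →+* B} (i : M →ₛₗ[φ] N) (p : B →+* T) {l : A →+* T}
    (h : p.comp φ = l) (m : M) (t : T) :
    ext i p h (tmul l m t) = tmul p (i m) t := by
  rw [ext, lift_tmul, tmul_eq_smul p]; rfl

theorem changeRing_changeRing {φ : A →+* R} {k : R →+* T} {ψ : A →+* T} (h : k.comp φ = ψ)
    {k' : T →+* T'} {χ : A →+* T'} (h' : k'.comp ψ = χ) {k'' : R →+* T'}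
    (h'' : k'.comp k = k'') (x : BaseChange φ M) :
    changeRing k' h' M (changeRing k h M x) =
      changeRing k'' (by rw [← h'', RingHom.comp_assoc, h, h']) M x := by
  subst h''
  induction x using BaseChange.induction_on with
  | zero => simp only [_root_.map_zero]
  | add x y hx hy => simp only [_root_.map_add, hx, hy]
  | tmul m r => simp only [changeRing_tmul]; rfl

theorem changeRing_id (φ : A →+* R) (x : BaseChange φ M) :
    changeRing (RingHom.id R) (RingHom.id_comp φ) M x = x := by
  induction x using BaseChange.induction_on with
  | zero => simp only [_root_.map_zero]
  | add x y hx hy => simp only [_root_.map_add, hx, hy]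
  | tmul m r => simp only [changeRing_tmul]; rfl

theorem changeRing_ext {φ : A →+* B} (i : M →ₛₗ[φ] N) {p : B →+* T} {l : A →+* T}
    (h : p.comp φ = l) (k : T →+* T') {p' : B →+* T'} (hp : k.comp p = p') {l' : A →+* T'}
    (hl : k.comp l = l') (x : BaseChange l M) :
    changeRing k hp N (ext i p h x) =
      ext i p' (by rw [← hp, RingHom.comp_assoc, h, hl]) (changeRing k hl M x) := by
  induction x using BaseChange.induction_on with
  | zero => simp only [_root_.map_zero]
  | add x y hx hy => simp only [_root_.map_add, hx, hy]
  | tmul m r => simp only [changeRing_tmul, ext_tmul]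

/-- If `i` exhibits `N` as `M ⊗_A B`, then it identifies `M ⊗_A T` with `N ⊗_B T`. -/
theorem ext_bijective {φ : A →+* B} (i : M →ₛₗ[φ] N)
    (hi : Function.Bijective (lift (RingHom.id B) (RingHom.id_comp φ) i)) (p : B →+* T)
    {l : A →+* T} (h : p.comp φ = l) : Function.Bijective (ext i p h) := by
  let e : BaseChange φ M ≃ₗ[B] N := LinearEquiv.ofBijective _ hi
  have he : ∀ m, e.symm (i m) = tmul φ m 1 := fun m => by
    rw [LinearEquiv.symm_apply_eq]; exact (lift_incl (RingHom.id B) (RingHom.id_comp φ) i m).symm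
  let inv : BaseChange p N →ₗ[T] BaseChange l M :=
    lift (RingHom.id T) (RingHom.id_comp p) ((changeRing p h M).comp e.symm.toLinearMap)
  have hinv : ∀ n, inv (tmul p n 1) = changeRing p h M (e.symm n) := fun n => by
    simp only [inv, lift_tmul, _root_.map_one, one_smul]; rfl
  refine Function.bijective_iff_has_inverse.2 ⟨inv, fun x => ?_, fun x => ?_⟩
  · refine semi_ext (s := inv.comp (ext i p h)) (t := LinearMap.id) (fun m => ?_) x
    rw [LinearMap.comp_apply, ext_tmul, hinv, he, changeRing_tmul, _root_.map_one]; rfl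
  · refine semi_ext (s := (ext i p h).comp inv) (t := LinearMap.id) (fun n => ?_) x
    rw [LinearMap.comp_apply, hinv, LinearMap.id_apply]
    obtain ⟨y, rfl⟩ := e.surjective n
    rw [LinearEquiv.symm_apply_apply]
    refine semi_ext (s := (ext i p h).comp (changeRing p h M))
      (t := (incl p N).comp e.toLinearMap) (fun m => ?_) y
    rw [LinearMap.comp_apply, changeRing_tmul, _root_.map_one, ext_tmul, LinearMap.comp_apply,
      incl_apply, ← he]
    exact congrArg (fun z => tmul p z 1) (e.apply_symm_apply _).symm

theorem ext_incl_bijective (φ : A →+* B) (p : B →+* T) {l : A →+* T} (h : p.comp φ = l) :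
    Function.Bijective (ext (incl φ M) p h) := by
  refine ext_bijective _ ?_ p h
  have : ∀ x, lift (RingHom.id B) (RingHom.id_comp φ) (incl φ M) x = x := changeRing_id φ
  rw [show ⇑(lift (RingHom.id B) (RingHom.id_comp φ) (incl φ M)) = id from funext this]
  exact Function.bijective_id

theorem ext_incl_changeRing {φ : A →+* R} {j : R →+* T} {ψ : A →+* T} (h : j.comp φ = ψ)
    (x : BaseChange φ M) :
    ext (incl φ M) j h (changeRing j h M x) = incl j (BaseChange φ M) x := by
  refine semi_ext (s := (ext (incl φ M) j h).comp (changeRing j h M)) (fun m => ?_) x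
  rw [LinearMap.comp_apply, changeRing_tmul, _root_.map_one, ext_tmul]; rfl

theorem changeRing_injective {φ : A →+* R} {j : R →+* T} (hj : j.FaithfullyFlat) {ψ : A →+* T}
    (h : j.comp φ = ψ) : Function.Injective (changeRing j h M) := by
  intro x y hxy
  apply incl_injective hj
  rw [← ext_incl_changeRing h, ← ext_incl_changeRing h, hxy]

/-! ### Tensor products over the base -/

/-- The map `N ⊗_{A, f} B → N ⊗_R (R ⊗_{φ, A, f} B)`, for an `R`-module `N`. -/
def toRTensor (φ : A →+* R) (f : A →+* B) (N : Type u) [AddCommGroup N] [Module R N] :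
    BaseChange f (Restrict φ N) →ₛₗ[RTensor.inr φ f] BaseChange (RTensor.inl φ f) N :=
  haveI : RingHomCompTriple φ (RTensor.inl φ f) ((RTensor.inl φ f).comp φ) := ⟨rfl⟩
  lift (RTensor.inr φ f) (RTensor.condition φ f)
    ((incl (RTensor.inl φ f) N).comp (Restrict.out φ N))

theorem toRTensor_tmul (φ : A →+* R) (f : A →+* B) {N : Type u} [AddCommGroup N] [Module R N]
    (n : Restrict φ N) (b : B) :
    toRTensor φ f N (tmul f n b) =
      tmul (RTensor.inl φ f) (Restrict.out φ N n) (RTensor.inr φ f b) := by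
  rw [toRTensor, lift_tmul, tmul_eq_smul (RTensor.inl φ f)]; rfl

theorem toRTensor_bijective (φ : A →+* R) (f : A →+* B) (N : Type u) [AddCommGroup N]
    [Module R N] : Function.Bijective (toRTensor φ f N) := by
  let act : N →+ (Along φ →ₗ[A] Restrict φ N) :=
    { toFun := fun n =>
        { toFun := fun r => (show N from ((Along.of φ).symm r • n))
          map_add' := fun r s => add_smul ((Along.of φ).symm r) ((Along.of φ).symm s) n
          map_smul' := fun a r => mul_smul (φ a) ((Along.of φ).symm r) n }
      map_zero' := LinearMap.ext fun r => smul_zero (A := N) ((Along.of φ).symm r)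
      map_add' := fun n n' => LinearMap.ext fun r => smul_add ((Along.of φ).symm r) n n' }
  let mulMap : N →+ (Along (RTensor.inl φ f) →+ BaseChange f (Restrict φ N)) :=
    { toFun := fun n => ((act n).rTensor (Along f)).toAddMonoidHom
      map_zero' := by
        rw [_root_.map_zero, LinearMap.rTensor_zero]; rfl
      map_add' := fun n n' => by
        rw [_root_.map_add, LinearMap.rTensor_add]; rfl }
  have bal : ∀ (r : R) (n : N) (d : Along (RTensor.inl φ f)),
      mulMap (r • n) d = mulMap n (r • d) := by
    intro r n d
    change Along φ ⊗[A] Along f at d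
    induction d using TensorProduct.induction_on with
    | zero =>
      exact (_root_.map_zero _).trans ((congrArg (mulMap n)
        (smul_zero (A := Along (RTensor.inl φ f)) r)).trans (_root_.map_zero _)).symm
    | add x y hx hy =>
      refine (_root_.map_add (mulMap (r • n)) x y).trans ?_
      refine (congrArg₂ (· + ·) hx hy).trans ?_
      refine (_root_.map_add (mulMap n) _ _).symm.trans (congrArg (mulMap n) ?_)
      exact (smul_add (A := Along (RTensor.inl φ f)) r x y).symm
    | tmul s b =>
      have e : (r • (show Along (RTensor.inl φ f) from s ⊗ₜ[A] b)) =
          (show Along (RTensor.inl φ f) from (Along.of φ r * s) ⊗ₜ[A] b) := by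
        rw [Algebra.smul_def]
        refine (Algebra.TensorProduct.tmul_mul_tmul (Along.of φ r) s 1 b).trans ?_
        rw [one_mul]
      refine Eq.trans ?_ (congrArg (mulMap n) e).symm
      change (act (r • n) s) ⊗ₜ[A] b = (act n (Along.of φ r * s)) ⊗ₜ[A] b
      congr 1
      change (Along.of φ).symm s • r • n = (r * (Along.of φ).symm s) • n
      rw [smul_smul, mul_comm]
  let inv : BaseChange (RTensor.inl φ f) N →+ BaseChange f (Restrict φ N) :=
    TensorProduct.liftAddHom mulMap bal
  have hinv : ∀ (n : N) (r : R) (b : B),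
      inv (tmul (RTensor.inl φ f) n (RTensor.inl φ f r * RTensor.inr φ f b)) =
        tmul f (Restrict.into φ N (r • n)) b := by
    intro n r b
    rw [RTensor.inl_mul_inr]; rfl
  refine Function.bijective_iff_has_inverse.2 ⟨inv, fun x => ?_, fun x => ?_⟩
  · induction x using BaseChange.induction_on with
    | zero => rw [_root_.map_zero, _root_.map_zero]
    | add x y hx hy => rw [_root_.map_add, _root_.map_add, hx, hy]
    | tmul n b =>
      have := hinv (Restrict.out φ N n) 1 b
      rw [_root_.map_one, one_mul, one_smul] at this
      rw [toRTensor_tmul]; exact this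
  · induction x using BaseChange.induction_on with
    | zero => rw [_root_.map_zero, _root_.map_zero]
    | add x y hx hy => rw [_root_.map_add, _root_.map_add, hx, hy]
    | tmul n d =>
      induction d using RTensor.induction_on with
      | zero => rw [tmul_zero, _root_.map_zero, _root_.map_zero]
      | add x y hx hy => rw [tmul_add, _root_.map_add, _root_.map_add, hx, hy]
      | mul r b =>
        rw [hinv, toRTensor_tmul]
        exact smul_tmul_eq (RTensor.inl φ f) r n (RTensor.inr φ f b)

end BaseChange

namespace BaseChange

variable {A B R T : Type u} [CommRing A] [CommRing B] [CommRing R] [CommRing T]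
variable {M : Type u} [AddCommGroup M] [Module A M]

theorem map_sub_apply (φ : A →+* R) {N : Type u} [AddCommGroup N] [Module A N]
    (g g' : M →ₗ[A] N) (x : BaseChange φ M) : map φ (g - g') x = map φ g x - map φ g' x := by
  rw [map_eq_rTensor, map_eq_rTensor, map_eq_rTensor, LinearMap.rTensor_sub]; rfl

theorem map_subtype_injective {f : A →+* B} (hf : f.Flat) (N : Submodule A M) :
    Function.Injective (map f N.subtype) := by
  have := Along.flat hf
  intro x y h
  rw [map_eq_rTensor, map_eq_rTensor] at h
  exact Module.Flat.rTensor_preserves_injective_linearMap N.subtype N.injective_subtype h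

/-- Flat extension of scalars preserves equalizers. -/
theorem exists_map_eqLocus {f : A →+* B} (hf : f.Flat) {N : Type u} [AddCommGroup N] [Module A N]
    (g g' : M →ₗ[A] N) (x : BaseChange f M) (h : map f g x = map f g' x) :
    ∃ y, map f (LinearMap.eqLocus g g').subtype y = x := by
  have := Along.flat hf
  have ex : Function.Exact (LinearMap.eqLocus g g').subtype (g - g') := by
    rw [LinearMap.eqLocus_eq_ker_sub]
    exact LinearMap.exact_subtype_ker_map _
  have h0 : map f (g - g') x = 0 := by rw [map_sub_apply, h, sub_self]
  rw [map_eq_rTensor] at h0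
  obtain ⟨y, hy⟩ := (Module.Flat.rTensor_exact (Along f) ex x).1 h0
  exact ⟨y, (map_eq_rTensor f _ y).trans hy⟩

/-- Faithfully flat descent for elements. -/
theorem exists_incl_of_map_incl {j : A →+* T} (hj : j.FaithfullyFlat) (x : BaseChange j M)
    (h : map j (Restrict.lin (incl j M)) x =
      incl j (Restrict j (BaseChange j M)) (Restrict.into j (BaseChange j M) x)) :
    ∃ y, incl j M y = x := by
  have := Along.faithfullyFlat hj
  let Q := Restrict j (BaseChange j M)
  let w : M →ₗ[A] Q := Restrict.lin (incl j M)
  let d₁ : Q →ₗ[A] Restrict j (BaseChange j Q) := Restrict.lin (incl j Q)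
  let d₂ : Q →ₗ[A] Restrict j (BaseChange j Q) :=
    Restrict.lin ((map j w).comp (Restrict.out j (BaseChange j M)))
  have split : ∀ z : BaseChange j Q, map j (d₁ - d₂) z = 0 → ∃ y, map j w y = z := by
    intro z hz
    let c : BaseChange j (Restrict j (BaseChange j Q)) →ₗ[T] BaseChange j Q :=
      lift (RingHom.id T) (RingHom.id_comp j) (Restrict.out j (BaseChange j Q))
    let c' : BaseChange j Q →ₗ[T] BaseChange j M :=
      lift (RingHom.id T) (RingHom.id_comp j) (Restrict.out j (BaseChange j M))
    have h1 : c.comp (map j d₁) = LinearMap.id := LinearMap.ext <| semi_ext fun q => by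
      rw [LinearMap.comp_apply, map_tmul]
      exact one_smul T (incl j Q q)
    have h2 : c.comp (map j d₂) = (map j w).comp c' := LinearMap.ext <| semi_ext fun q => by
      rw [LinearMap.comp_apply, map_tmul, LinearMap.comp_apply, lift_tmul, lift_tmul,
        RingHom.id_apply, one_smul, one_smul]
      rfl
    rw [map_sub_apply, sub_eq_zero] at hz
    refine ⟨c' z, (LinearMap.congr_fun h2 z).symm.trans ?_⟩
    rw [LinearMap.comp_apply, ← hz]
    exact LinearMap.congr_fun h1 z
  have ex : Function.Exact w (d₁ - d₂) := by
    refine Module.FaithfullyFlat.rTensor_reflects_exact A (Along j) _ _ fun z => ⟨fun hz => ?_, ?_⟩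
    · obtain ⟨y, hy⟩ := split z ((map_eq_rTensor j (d₁ - d₂) z).trans hz)
      exact ⟨y, (map_eq_rTensor j w y).symm.trans hy⟩
    · rintro ⟨y, rfl⟩
      rw [← LinearMap.comp_apply, ← LinearMap.rTensor_comp]
      have : (d₁ - d₂) ∘ₗ w = 0 := LinearMap.ext fun m =>
        sub_eq_zero.2 (map_tmul j w m 1).symm
      rw [this, LinearMap.rTensor_zero]; rfl
  obtain ⟨y, hy⟩ := (ex x).1 (sub_eq_zero.2 h.symm)
  exact ⟨y, hy⟩

/-- Faithfully flat descent for elements: an element of `M ⊗_A T` comes from `M ⊗_A R` if its two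
images in `M ⊗_A (T ⊗_R T)` agree. -/
theorem exists_changeRing {φ : A →+* R} {j : R →+* T} (hj : j.FaithfullyFlat) {ψ : A →+* T}
    (h : j.comp φ = ψ) {l : A →+* RTensor j j} (hl : (RTensor.inl j j).comp ψ = l)
    (hr : (RTensor.inr j j).comp ψ = l) (x : BaseChange ψ M)
    (hx : changeRing (RTensor.inl j j) hl M x = changeRing (RTensor.inr j j) hr M x) :
    ∃ y, changeRing j h M y = x := by
  have main : ∃ y, incl j (BaseChange φ M) y = ext (incl φ M) j h x := by
    apply exists_incl_of_map_incl hj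
    apply (toRTensor_bijective j j (BaseChange j (BaseChange φ M))).1
    have e1 : ∀ z : BaseChange j (BaseChange φ M),
        toRTensor j j _ (map j (Restrict.lin (incl j (BaseChange φ M))) z) =
          ext (incl j (BaseChange φ M)) (RTensor.inl j j) rfl
            (changeRing (RTensor.inr j j) (RTensor.condition j j) _ z) := by
      intro z
      refine semi_ext (s := (toRTensor j j _).comp (map j (Restrict.lin (incl j (BaseChange φ M)))))
        (t := (ext (incl j (BaseChange φ M)) (RTensor.inl j j) rfl).comp
          (changeRing (RTensor.inr j j) (RTensor.condition j j) _)) (fun n => ?_) z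
      simp only [LinearMap.comp_apply, map_tmul, toRTensor_tmul, changeRing_tmul, ext_tmul]
      rfl
    have e2 : ∀ z : BaseChange j (BaseChange φ M),
        toRTensor j j _ (incl j (Restrict j (BaseChange j (BaseChange φ M)))
          (Restrict.into j (BaseChange j (BaseChange φ M)) z)) =
          ext (incl j (BaseChange φ M)) (RTensor.inl j j) rfl
            (changeRing (RTensor.inl j j) rfl _ z) := by
      intro z
      rw [incl_apply, toRTensor_tmul, _root_.map_one]
      refine semi_ext (s := incl (RTensor.inl j j) (BaseChange j (BaseChange φ M)))
        (t := (ext (incl j (BaseChange φ M)) (RTensor.inl j j) rfl).comp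
          (changeRing (RTensor.inl j j) rfl _)) (fun n => ?_) z
      simp only [LinearMap.comp_apply, changeRing_tmul, ext_tmul, incl_apply, _root_.map_one]
    rw [e1, e2, changeRing_ext (incl φ M) h (RTensor.inl j j) rfl hl,
      changeRing_ext (incl φ M) h (RTensor.inr j j) (RTensor.condition j j) hr, hx]
  obtain ⟨y, hy⟩ := main
  exact ⟨y, (ext_incl_bijective φ j h).1 ((ext_incl_changeRing h y).trans hy)⟩

end BaseChange

namespace HopfAlgebroid

variable {A Γ B S T T' : Type u} [CommRing A] [CommRing Γ] [CommRing B] [CommRing S] [CommRing T]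
variable [CommRing T']

theorem lift_counit_left (H : HopfAlgebroid A Γ) (q : Γ →+* T) {l : A →+* T}
    (hq : q.comp H.etaL = l) (h : q.comp H.etaL = (l.comp H.eps).comp H.etaR) :
    (RTensor.lift (l.comp H.eps) q h).comp H.comul = q := by
  refine Eq.trans ?_ (congrArg q.comp H.counit_left)
  rw [← RingHom.comp_assoc]
  congr 1
  subst hq
  exact RTensor.hom_ext (by ext; simp) (by ext; simp)

theorem lift_counit_right (H : HopfAlgebroid A Γ) (q : Γ →+* T) {r : A →+* T}
    (hq : q.comp H.etaR = r) (h : (r.comp H.eps).comp H.etaL = q.comp H.etaR) :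
    (RTensor.lift q (r.comp H.eps) h).comp H.comul = q := by
  refine Eq.trans ?_ (congrArg q.comp H.counit_right)
  rw [← RingHom.comp_assoc]
  congr 1
  subst hq
  exact RTensor.hom_ext (by ext; simp) (by ext; simp)

namespace RCoMod

open BaseChange

variable {H : HopfAlgebroid A Γ} (M N : RCoMod H)

/-- The action of the morphism `g : Γ → T` with source `l` and target `r`. -/
def act (g : Γ →+* T) {l r : A →+* T} (hl : g.comp H.etaL = l) (hr : g.comp H.etaR = r) :
    M.carrier →ₛₗ[r] BaseChange l M.carrier :=
  haveI : RingHomCompTriple H.etaR g r := ⟨hr⟩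
  (changeRing g hl M.carrier).comp M.coact

theorem act_apply (g : Γ →+* T) {l r : A →+* T} (hl : g.comp H.etaL = l)
    (hr : g.comp H.etaR = r) (m : M.carrier) :
    M.act g hl hr m = changeRing g hl M.carrier (M.coact m) := rfl

theorem changeRing_act (g : Γ →+* T) {l r : A →+* T} (hl : g.comp H.etaL = l)
    (hr : g.comp H.etaR = r) (k : T →+* T') {l' r' : A →+* T'} (hl' : k.comp l = l')
    (hr' : k.comp r = r') {g' : Γ →+* T'} (hg : k.comp g = g') (m : M.carrier) :
    changeRing k hl' M.carrier (M.act g hl hr m) =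
      M.act g' (by rw [← hg, RingHom.comp_assoc, hl, hl'])
        (by rw [← hg, RingHom.comp_assoc, hr, hr']) m :=
  changeRing_changeRing hl hl' hg _

/-- The `T`-linear extension of the action of `g : Γ → T`. -/
def transport (g : Γ →+* T) {l r : A →+* T} (hl : g.comp H.etaL = l)
    (hr : g.comp H.etaR = r) : BaseChange r M.carrier →ₗ[T] BaseChange l M.carrier :=
  BaseChange.lift (RingHom.id T) (RingHom.id_comp r) (M.act g hl hr)

theorem transport_tmul_one (g : Γ →+* T) {l r : A →+* T} (hl : g.comp H.etaL = l)
    (hr : g.comp H.etaR = r) (m : M.carrier) :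
    M.transport g hl hr (tmul r m 1) = M.act g hl hr m := by
  rw [transport, BaseChange.lift_tmul, map_one, one_smul]

/-- The action is compatible with composition. -/
theorem transport_act {g g' g'' : Γ →+* T} {l s r : A →+* T} (hl : g.comp H.etaL = l)
    (hs : g.comp H.etaR = s) (hs' : g'.comp H.etaL = s) (hr : g'.comp H.etaR = r)
    (hl'' : g''.comp H.etaL = l) (hr'' : g''.comp H.etaR = r)
    (h : (RTensor.lift g g' (hs'.trans hs.symm)).comp H.comul = g'') (m : M.carrier) :
    M.transport g hl hs (M.act g' hs' hr m) = M.act g'' hl'' hr'' m := by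
  have hp : (RTensor.lift g g' (hs'.trans hs.symm)).comp H.etaLL = l := by
    rw [etaLL, ← RingHom.comp_assoc, RTensor.lift_comp_inl, hl]
  have key : ∀ y : BaseChange H.etaL M.carrier,
      changeRing (RTensor.lift g g' (hs'.trans hs.symm)) hp M.carrier (H.coactId M.coact y) =
        M.transport g hl hs (changeRing g' hs' M.carrier y) := by
    intro y
    induction y using BaseChange.induction_on with
    | zero => simp only [map_zero]
    | add x y hx hy => simp only [map_add, hx, hy]
    | tmul m γ =>
      rw [changeRing_tmul, tmul_eq_smul H.etaL, tmul_eq_smul s, LinearMap.map_smulₛₗ,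
        LinearMap.map_smulₛₗ, RTensor.lift_inr, LinearMap.map_smul, transport_tmul_one]
      refine congrArg _ ?_
      refine Eq.trans (congrArg _ (BaseChange.lift_incl _ _ _ m)) ?_
      exact changeRing_changeRing rfl hp (RTensor.lift_comp_inl g g' _) (M.coact m)
  rw [act_apply, ← key, ← M.coassoc]
  exact changeRing_changeRing (ψ := H.etaLL) H.comul_etaL hp h (M.coact m)

/-- The action is compatible with identities. -/
theorem act_eps (k : A →+* T) (hl : (k.comp H.eps).comp H.etaL = k)
    (hr : (k.comp H.eps).comp H.etaR = k) (m : M.carrier) :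
    M.act (k.comp H.eps) hl hr m = tmul k m 1 := by
  have key : ∀ y : BaseChange H.etaL M.carrier,
      changeRing (k.comp H.eps) hl M.carrier y = incl k M.carrier (H.idEps M.carrier y) := by
    intro y
    induction y using BaseChange.induction_on with
    | zero => simp only [map_zero]
    | add x y hx hy => simp only [map_add, hx, hy]
    | tmul m γ =>
      rw [changeRing_tmul, idEps, BaseChange.lift_tmul, LinearMap.map_smulₛₗ]
      exact tmul_eq_smul k m _
  rw [act_apply, key, M.counit]; rfl

variable {M N}

theorem act_hom (u : M ⟶ N) (g : Γ →+* T) {l r : A →+* T} (hl : g.comp H.etaL = l)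
    (hr : g.comp H.etaR = r) (m : M.carrier) :
    N.act g hl hr (u.toLin m) = BaseChange.map l u.toLin (M.act g hl hr m) := by
  rw [act_apply, act_apply, u.comm]
  generalize M.coact m = y
  induction y using BaseChange.induction_on with
  | zero => simp only [map_zero]
  | add x y hx hy => simp only [map_add, hx, hy]
  | tmul m γ => simp only [BaseChange.map_tmul, changeRing_tmul]

/-- A bijective morphism of comodules is an isomorphism. -/
noncomputable def isoOfBijective (u : M ⟶ N) (hu : Function.Bijective u.toLin) : M ≅ N :=
  let e := LinearEquiv.ofBijective u.toLin hu
  have he : u.toLin.comp e.symm.toLinearMap = LinearMap.id :=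
    LinearMap.ext fun n => e.apply_symm_apply n
  have he' : e.symm.toLinearMap.comp u.toLin = LinearMap.id :=
    LinearMap.ext fun n => e.symm_apply_apply n
  { hom := u
    inv :=
      { toLin := e.symm.toLinearMap
        comm := fun n => by
          obtain ⟨m, rfl⟩ := hu.2 n
          have h := LinearMap.congr_fun
            (BaseChange.map_comp H.etaL u.toLin e.symm.toLinearMap) (M.coact m)
          rw [he', BaseChange.map_id] at h
          rw [u.comm]
          refine Eq.trans ?_ h
          exact congrArg M.coact (LinearMap.congr_fun he' m) }
    hom_inv_id := RCoMod.hom_ext he'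
    inv_hom_id := RCoMod.hom_ext he }

end RCoMod

theorem Hom.changeRing_pullbackCoact {H : HopfAlgebroid A Γ} {K : HopfAlgebroid B S} (F : Hom H K)
    (M : RCoMod H) (g : S →+* T) {g' : Γ →+* T} (hg : g.comp F.onMor = g') {p : B →+* T}
    (hp : g.comp K.etaL = p) {l r : A →+* T} (hl : p.comp F.onObj = l)
    (hl' : g'.comp H.etaL = l) (hr' : g'.comp H.etaR = r) (m : M.carrier) :
    BaseChange.changeRing g hp _ (F.pullbackCoact M (BaseChange.incl F.onObj M.carrier m)) =
      BaseChange.ext (BaseChange.incl F.onObj M.carrier) p hl (M.act g' hl' hr' m) := by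
  rw [F.pullbackCoact_incl, RCoMod.act_apply]
  generalize M.coact m = y
  subst hg
  induction y using BaseChange.induction_on with
  | zero => simp only [map_zero]
  | add x y hx hy => simp only [map_add, hx, hy]
  | tmul m γ =>
    rw [F.transfer_tmul, BaseChange.changeRing_tmul, BaseChange.changeRing_tmul,
      BaseChange.ext_tmul]; rfl

end HopfAlgebroid

namespace HopfAlgebroid

variable {A Γ B T T' : Type u} [CommRing A] [CommRing Γ] [CommRing B] [CommRing T] [CommRing T']
variable {H : HopfAlgebroid A Γ} {f : A →+* B}

theorem comp_lift3 (p : B →+* T) (q : Γ →+* T) (r : B →+* T) (h : q.comp H.etaL = p.comp f)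
    (h' : r.comp f = q.comp H.etaR) (k : T →+* T') :
    k.comp (lift3 p q r h h') = lift3 (k.comp p) (k.comp q) (k.comp r)
      (by rw [RingHom.comp_assoc, h, RingHom.comp_assoc])
      (by rw [RingHom.comp_assoc, h', RingHom.comp_assoc]) := by
  apply hom_ext3 <;> (ext; simp)

theorem comp_in_eq_lift3 (k : H.BaseChangeRing f →+* T) :
    k = lift3 (k.comp (H.in1 f)) (k.comp (H.in2 f)) (k.comp (H.in3 f))
      (by rw [RingHom.comp_assoc, in2_etaL, RingHom.comp_assoc])
      (by rw [RingHom.comp_assoc, in3_comp, RingHom.comp_assoc]) := by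
  apply hom_ext3 <;> (ext; simp)

theorem lift_lift3_comul {p s r : B →+* T} {q q' q'' : Γ →+* T} (h₁ : q.comp H.etaL = p.comp f)
    (h₂ : s.comp f = q.comp H.etaR) (h₃ : q'.comp H.etaL = s.comp f)
    (h₄ : r.comp f = q'.comp H.etaR) (h₅ : q''.comp H.etaL = p.comp f)
    (h₆ : r.comp f = q''.comp H.etaR)
    (hq : (RTensor.lift q q' (h₃.trans h₂)).comp H.comul = q'')
    (h : (lift3 s q' r h₃ h₄).comp (H.in1 f) = (lift3 p q s h₁ h₂).comp (H.in3 f)) :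
    (RTensor.lift (lift3 p q s h₁ h₂) (lift3 s q' r h₃ h₄) h).comp (H.baseChangeComul f) =
      lift3 p q'' r h₅ h₆ := by
  apply hom_ext3
  · ext b; simp
  · ext g
    rw [RingHom.comp_apply, RingHom.comp_apply, RingHom.comp_apply, baseChangeComul_in2,
      apply_in2Tensor H f _ (RTensor.lift q q' (h₃.trans h₂)) (RingHom.id T), lift3_in2, ← hq]
    · rfl
    · intro g; simp
    · intro g; simp
  · ext b; simp

namespace RCoMod

open BaseChange

section Action

variable (N : RCoMod (H.baseChange f))

/-- The structure map, expressed through the inclusions of the outer factors of `Γ_f`. -/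
def coact₃ : N.carrier →ₛₗ[H.in3 f] BaseChange (H.in1 f) N.carrier := N.coact

/-- The action of the morphism `(p, q, r) : Γ_f → T`. -/
def act₃ (p : B →+* T) (q : Γ →+* T) (r : B →+* T) (h : q.comp H.etaL = p.comp f)
    (h' : r.comp f = q.comp H.etaR) : N.carrier →ₛₗ[r] BaseChange p N.carrier :=
  N.act (lift3 p q r h h') (lift3_comp_in1 p q r h h') (lift3_comp_in3 p q r h h')

/-- The linear extension of the action of the morphism `(p, q, r) : Γ_f → T`. -/
def transport₃ (p : B →+* T) (q : Γ →+* T) (r : B →+* T) (h : q.comp H.etaL = p.comp f)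
    (h' : r.comp f = q.comp H.etaR) : BaseChange r N.carrier →ₗ[T] BaseChange p N.carrier :=
  N.transport (lift3 p q r h h') (lift3_comp_in1 p q r h h') (lift3_comp_in3 p q r h h')

theorem transport₃_tmul_one (p : B →+* T) (q : Γ →+* T) (r : B →+* T)
    (h : q.comp H.etaL = p.comp f) (h' : r.comp f = q.comp H.etaR) (n : N.carrier) :
    N.transport₃ p q r h h' (tmul r n 1) = N.act₃ p q r h h' n :=
  N.transport_tmul_one ..

theorem changeRing_act₃ {p : B →+* T} {q : Γ →+* T} {r : B →+* T}
    (h : q.comp H.etaL = p.comp f) (h' : r.comp f = q.comp H.etaR) (k : T →+* T')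
    {p' : B →+* T'} {q' : Γ →+* T'} {r' : B →+* T'} (hp : k.comp p = p') (hq : k.comp q = q')
    (hr : k.comp r = r') (n : N.carrier) :
    changeRing k hp N.carrier (N.act₃ p q r h h' n) =
      N.act₃ p' q' r' (by rw [← hp, ← hq, RingHom.comp_assoc, h, RingHom.comp_assoc])
        (by rw [← hr, ← hq, RingHom.comp_assoc, h', RingHom.comp_assoc]) n := by
  subst hp hq hr
  exact N.changeRing_act _ _ _ k rfl rfl (comp_lift3 p q r h h' k) n

theorem changeRing_coact₃ (k : H.BaseChangeRing f →+* T) {p : B →+* T} {q : Γ →+* T} {r : B →+* T}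
    (hp : k.comp (H.in1 f) = p) (hq : k.comp (H.in2 f) = q) (hr : k.comp (H.in3 f) = r)
    (n : N.carrier) :
    changeRing k hp N.carrier (N.coact₃ n) =
      N.act₃ p q r (by rw [← hp, ← hq, RingHom.comp_assoc, in2_etaL, RingHom.comp_assoc])
        (by rw [← hr, ← hq, RingHom.comp_assoc, in3_comp, RingHom.comp_assoc]) n := by
  subst hp hq hr
  have e : ∀ (k' : H.BaseChangeRing f →+* T) (hk : k = k')
      (h' : k'.comp (H.in1 f) = k.comp (H.in1 f)),
      changeRing k rfl N.carrier (N.coact₃ n) = changeRing k' h' N.carrier (N.coact₃ n) := by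
    rintro k' rfl h'; rfl
  exact e _ (comp_in_eq_lift3 k) (lift3_comp_in1 ..)

theorem transport₃_act₃ {p s r : B →+* T} {q q' q'' : Γ →+* T} (h₁ : q.comp H.etaL = p.comp f)
    (h₂ : s.comp f = q.comp H.etaR) (h₃ : q'.comp H.etaL = s.comp f)
    (h₄ : r.comp f = q'.comp H.etaR) (h₅ : q''.comp H.etaL = p.comp f)
    (h₆ : r.comp f = q''.comp H.etaR)
    (hq : (RTensor.lift q q' (h₃.trans h₂)).comp H.comul = q'') (n : N.carrier) :
    N.transport₃ p q s h₁ h₂ (N.act₃ s q' r h₃ h₄ n) = N.act₃ p q'' r h₅ h₆ n :=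
  N.transport_act _ _ _ _ _ _ (lift_lift3_comul h₁ h₂ h₃ h₄ h₅ h₆ hq _) n

end Action

section Descent

theorem unit_etaL (H : HopfAlgebroid A Γ) (l : A →+* T) : (l.comp H.eps).comp H.etaL = l := by
  rw [RingHom.comp_assoc, H.eps_etaL]; rfl

theorem unit_etaR (H : HopfAlgebroid A Γ) (l : A →+* T) : (l.comp H.eps).comp H.etaR = l := by
  rw [RingHom.comp_assoc, H.eps_etaR]; rfl

variable (N : RCoMod (H.baseChange f))

/-- The descent datum along `f` of a comodule over `Γ_f`: the action of the identity morphism of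
an object `l`, regarded as a morphism between two lifts `p` and `r` of `l`. -/
def glue (p r : B →+* T) {l : A →+* T} (hp : p.comp f = l) (hr : r.comp f = l) :
    N.carrier →ₛₗ[r] BaseChange p N.carrier :=
  N.act₃ p (l.comp H.eps) r ((unit_etaL H l).trans hp.symm) (hr.trans (unit_etaR H l).symm)

/-- The linear extension of `glue`. -/
def glueLin (p r : B →+* T) {l : A →+* T} (hp : p.comp f = l) (hr : r.comp f = l) :
    BaseChange r N.carrier →ₗ[T] BaseChange p N.carrier :=
  N.transport₃ p (l.comp H.eps) r ((unit_etaL H l).trans hp.symm) (hr.trans (unit_etaR H l).symm)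

theorem glueLin_tmul_one (p r : B →+* T) {l : A →+* T} (hp : p.comp f = l) (hr : r.comp f = l)
    (n : N.carrier) : N.glueLin p r hp hr (tmul r n 1) = N.glue p r hp hr n :=
  N.transport₃_tmul_one ..

theorem changeRing_glue {p r : B →+* T} {l : A →+* T} (hp : p.comp f = l) (hr : r.comp f = l)
    (k : T →+* T') {p' r' : B →+* T'} {l' : A →+* T'} (hkp : k.comp p = p')
    (hkr : k.comp r = r') (hp' : p'.comp f = l') (hr' : r'.comp f = l') (n : N.carrier) :
    changeRing k hkp N.carrier (N.glue p r hp hr n) = N.glue p' r' hp' hr' n := by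
  have hl : k.comp l = l' := by rw [← hp, ← RingHom.comp_assoc, hkp, hp']
  subst hl
  exact N.changeRing_act₃ _ _ k hkp rfl hkr n

theorem glueLin_act₃ {p s r : B →+* T} {q : Γ →+* T} {l : A →+* T} (hp : p.comp f = l)
    (hs : s.comp f = l) (h : q.comp H.etaL = s.comp f) (h' : r.comp f = q.comp H.etaR)
    (n : N.carrier) :
    N.glueLin p s hp hs (N.act₃ s q r h h' n) =
      N.act₃ p q r (h.trans (hs.trans hp.symm)) h' n :=
  N.transport₃_act₃ _ _ _ _ _ _ (lift_counit_left H q (h.trans hs) _) n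

theorem transport₃_glue {p s r : B →+* T} {q : Γ →+* T} {l : A →+* T}
    (h : q.comp H.etaL = p.comp f) (h' : s.comp f = q.comp H.etaR) (hs : s.comp f = l)
    (hr : r.comp f = l) (n : N.carrier) :
    N.transport₃ p q s h h' (N.glue s r hs hr n) =
      N.act₃ p q r h (hr.trans (hs.symm.trans h')) n :=
  N.transport₃_act₃ _ _ _ _ _ _ (lift_counit_right H q (h'.symm.trans hs) _) n

theorem glueLin_glue {p s r : B →+* T} {l : A →+* T} (hp : p.comp f = l) (hs : s.comp f = l)
    (hr : r.comp f = l) (n : N.carrier) :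
    N.glueLin p s hp hs (N.glue s r hs hr n) = N.glue p r hp hr n :=
  N.glueLin_act₃ hp hs _ _ n

theorem glue_self (n : N.carrier) :
    N.glue (RingHom.id B) (RingHom.id B) (RingHom.id_comp f) (RingHom.id_comp f) n =
      tmul (RingHom.id B) n 1 :=
  N.act_eps (RingHom.id B)
    (by rw [RingHom.comp_assoc, (H.baseChange f).eps_etaL]; rfl)
    (by rw [RingHom.comp_assoc, (H.baseChange f).eps_etaR]; rfl) n

end Descent

end RCoMod

end HopfAlgebroid

namespace HopfAlgebroid

namespace RCoMod

open BaseChange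

variable {A Γ B T : Type u} [CommRing A] [CommRing Γ] [CommRing B] [CommRing T]
variable {H : HopfAlgebroid A Γ} {f : A →+* B} (N : RCoMod (H.baseChange f))

/-- The map `n ↦ ψ n` to `N ⊗_A B` given by the descent datum of `N`. -/
def glueRestrict : Restrict f N.carrier →ₗ[A]
    Restrict ((RTensor.inl f f).comp f) (BaseChange (RTensor.inl f f) N.carrier) :=
  Restrict.map (RTensor.condition f f)
    (N.glue (RTensor.inl f f) (RTensor.inr f f) rfl (RTensor.condition f f))

/-- The map `n ↦ n ⊗ 1` to `N ⊗_A B`. -/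
def inclRestrict : Restrict f N.carrier →ₗ[A]
    Restrict ((RTensor.inl f f).comp f) (BaseChange (RTensor.inl f f) N.carrier) :=
  Restrict.map rfl (incl (RTensor.inl f f) N.carrier)

/-- The `A`-module of elements of `N` that are invariant under the descent datum. -/
abbrev Invariants : Type u := LinearMap.eqLocus N.glueRestrict N.inclRestrict

/-- The inclusion of the invariants. -/
def ofInvariants : N.Invariants →ₛₗ[f] N.carrier :=
  (Restrict.out f N.carrier).comp (LinearMap.eqLocus N.glueRestrict N.inclRestrict).subtype

theorem ofInvariants_injective : Function.Injective N.ofInvariants :=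
  fun _ _ h => Subtype.ext h

theorem glue_ofInvariants_tensor (m : N.Invariants) :
    N.glue (RTensor.inl f f) (RTensor.inr f f) rfl (RTensor.condition f f) (N.ofInvariants m) =
      tmul (RTensor.inl f f) (N.ofInvariants m) 1 :=
  m.2

theorem map_glueRestrict_eq (x : BaseChange f (Restrict f N.carrier)) (n : N.carrier)
    (h : toRTensor f f N.carrier x =
      N.glue (RTensor.inl f f) (RTensor.inr f f) rfl (RTensor.condition f f) n) :
    BaseChange.map f N.glueRestrict x = BaseChange.map f N.inclRestrict x := by
  let l : A →+* RTensor f f := (RTensor.inl f f).comp f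
  let j : RTensor f f →+* RTensor l f := RTensor.inl l f
  let b₁ : B →+* RTensor l f := j.comp (RTensor.inl f f)
  let b₂ : B →+* RTensor l f := j.comp (RTensor.inr f f)
  let b₃ : B →+* RTensor l f := RTensor.inr l f
  have h₁ : b₁.comp f = j.comp l := rfl
  have h₂ : b₂.comp f = j.comp l := by
    simp only [b₂, l, RingHom.comp_assoc, RTensor.condition]
  have h₃ : b₃.comp f = j.comp l := RTensor.condition l f
  let w₁ : RTensor f f →+* RTensor l f := RTensor.lift b₁ b₃ (h₃.trans h₁.symm)
  let w₂ : RTensor f f →+* RTensor l f := RTensor.lift b₂ b₃ (h₃.trans h₂.symm)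
  have e₁ : ∀ x, toRTensor l f _ (BaseChange.map f N.glueRestrict x) =
      ext (incl (RTensor.inl f f) N.carrier) j rfl (N.glueLin b₁ b₂ h₁ h₂
        (changeRing w₂ (RTensor.lift_comp_inl _ _ _) N.carrier (toRTensor f f N.carrier x))) := by
    intro x
    induction x using BaseChange.induction_on with
    | zero => simp only [map_zero]
    | add x y hx hy => simp only [map_add, hx, hy]
    | tmul n b =>
      rw [BaseChange.map_tmul, toRTensor_tmul, toRTensor_tmul, changeRing_tmul, RTensor.lift_inr,
        tmul_eq_smul, tmul_eq_smul b₂, LinearMap.map_smul, LinearMap.map_smul, glueLin_tmul_one,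
        ← N.changeRing_glue rfl (RTensor.condition f f) j rfl rfl h₁ h₂, ext_incl_changeRing]
      rfl
  have e₂ : ∀ x, toRTensor l f _ (BaseChange.map f N.inclRestrict x) =
      ext (incl (RTensor.inl f f) N.carrier) j rfl
        (changeRing w₁ (RTensor.lift_comp_inl _ _ _) N.carrier (toRTensor f f N.carrier x)) := by
    intro x
    induction x using BaseChange.induction_on with
    | zero => simp only [map_zero]
    | add x y hx hy => simp only [map_add, hx, hy]
    | tmul n b =>
      rw [BaseChange.map_tmul, toRTensor_tmul, toRTensor_tmul, changeRing_tmul, RTensor.lift_inr,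
        ext_tmul]
      rfl
  apply (toRTensor_bijective l f (BaseChange (RTensor.inl f f) N.carrier)).1
  rw [e₁, e₂, h,
    N.changeRing_glue rfl (RTensor.condition f f) w₂ _ (RTensor.lift_comp_inr _ _ _) h₂ h₃,
    N.changeRing_glue rfl (RTensor.condition f f) w₁ _ (RTensor.lift_comp_inr _ _ _) h₁ h₃,
    glueLin_glue]

/-- Faithfully flat descent for modules: `N` is generated by its invariants. -/
theorem lift_ofInvariants_bijective (hf : f.Flat) :
    Function.Bijective (BaseChange.lift (RingHom.id B) (RingHom.id_comp f) N.ofInvariants) := by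
  constructor
  · have key : ∀ x, N.glue (RTensor.inl f f) (RTensor.inr f f) rfl (RTensor.condition f f)
        (BaseChange.lift (RingHom.id B) (RingHom.id_comp f) N.ofInvariants x) =
          toRTensor f f N.carrier (BaseChange.map f
            (LinearMap.eqLocus N.glueRestrict N.inclRestrict).subtype x) := by
      intro x
      induction x using BaseChange.induction_on with
      | zero => simp only [map_zero]
      | add x y hx hy => simp only [map_add, hx, hy]
      | tmul m b =>
        rw [BaseChange.lift_tmul, LinearMap.map_smulₛₗ, glue_ofInvariants_tensor,
          BaseChange.map_tmul, toRTensor_tmul, ← tmul_eq_smul]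
        rfl
    intro x y hxy
    apply map_subtype_injective hf (LinearMap.eqLocus N.glueRestrict N.inclRestrict)
    apply (toRTensor_bijective f f N.carrier).1
    rw [← key, ← key, hxy]
  · intro n
    obtain ⟨x, hx⟩ := (toRTensor_bijective f f N.carrier).2
      (N.glue (RTensor.inl f f) (RTensor.inr f f) rfl (RTensor.condition f f) n)
    obtain ⟨y, rfl⟩ := exists_map_eqLocus hf _ _ x (N.map_glueRestrict_eq x n hx)
    refine ⟨y, incl_injective (φ := RingHom.id B)
      (RingHom.FaithfullyFlat.of_bijective Function.bijective_id) ?_⟩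
    rw [incl_apply, incl_apply, ← N.glue_self n,
      ← N.changeRing_glue rfl (RTensor.condition f f)
        (RTensor.lift (RingHom.id B) (RingHom.id B) rfl) (RTensor.lift_comp_inl _ _ _)
        (RTensor.lift_comp_inr _ _ _) _ _ n, ← hx]
    clear hx
    induction y using BaseChange.induction_on with
    | zero => simp only [map_zero]; exact map_zero (incl (RingHom.id B) N.carrier)
    | add x y hx hy =>
      simp only [map_add, ← hx, ← hy]; exact map_add (incl (RingHom.id B) N.carrier) _ _
    | tmul m b =>
      rw [BaseChange.lift_tmul, BaseChange.map_tmul, toRTensor_tmul, changeRing_tmul,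
        RTensor.lift_inr, smul_tmul_eq, mul_one]
      rfl

theorem glue_ofInvariants {p r : B →+* T} {l : A →+* T} (hp : p.comp f = l) (hr : r.comp f = l)
    (m : N.Invariants) : N.glue p r hp hr (N.ofInvariants m) = tmul p (N.ofInvariants m) 1 := by
  rw [← N.changeRing_glue rfl (RTensor.condition f f) (RTensor.lift p r (hr.trans hp.symm))
    (RTensor.lift_comp_inl _ _ _) (RTensor.lift_comp_inr _ _ _), glue_ofInvariants_tensor,
    changeRing_tmul, map_one]

theorem glueLin_ext {p r : B →+* T} {l : A →+* T} (hp : p.comp f = l) (hr : r.comp f = l)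
    (z : BaseChange l N.Invariants) :
    N.glueLin p r hp hr (ext N.ofInvariants r hr z) = ext N.ofInvariants p hp z := by
  refine semi_ext (s := (N.glueLin p r hp hr).comp (ext N.ofInvariants r hr))
    (fun m => ?_) z
  rw [LinearMap.comp_apply, ext_tmul, glueLin_tmul_one, glue_ofInvariants, ext_tmul]

end RCoMod

end HopfAlgebroid

namespace HopfAlgebroid

open BaseChange

variable {A Γ B T : Type u} [CommRing A] [CommRing Γ] [CommRing B] [CommRing T]
variable {H : HopfAlgebroid A Γ} {f : A →+* B}

theorem in2_faithfullyFlat (H : HopfAlgebroid A Γ) (hf : f.FaithfullyFlat) :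
    (H.in2 f).FaithfullyFlat :=
  RingHom.FaithfullyFlat.stableUnderComposition _ _ (RTensor.inr_faithfullyFlat H.etaL hf)
    (RTensor.inl_faithfullyFlat _ hf)

namespace RCoMod

variable (N : RCoMod (H.baseChange f))

/-- The identification of an element of `M ⊗_A Γ` with an element of `N ⊗_B Γ_f`, where `M` is
the module of invariants of `N`. -/
def expand : BaseChange H.etaL N.Invariants →ₛₗ[H.in2 f] BaseChange (H.in1 f) N.carrier :=
  (ext N.ofInvariants (H.in1 f) rfl).comp (changeRing (H.in2 f) (H.in2_etaL f) N.Invariants)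

theorem expand_tmul (m : N.Invariants) (g : Γ) :
    N.expand (tmul H.etaL m g) = tmul (H.in1 f) (N.ofInvariants m) (H.in2 f g) := by
  rw [expand, LinearMap.comp_apply, changeRing_tmul, ext_tmul]

variable {N} in
theorem expand_injective (hf : f.FaithfullyFlat) : Function.Injective N.expand :=
  (ext_bijective N.ofInvariants (N.lift_ofInvariants_bijective hf.flat) (H.in1 f) rfl).1.comp
    (changeRing_injective (in2_faithfullyFlat H hf) _)

theorem exists_expand (hf : f.FaithfullyFlat) (m : N.Invariants) :
    ∃ y, N.expand y = N.coact₃ (N.ofInvariants m) := by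
  obtain ⟨x, hx⟩ := (ext_bijective N.ofInvariants (N.lift_ofInvariants_bijective hf.flat)
    (H.in1 f) rfl).2 (N.coact₃ (N.ofInvariants m))
  let k₁ := RTensor.inl (H.in2 f) (H.in2 f)
  let k₂ := RTensor.inr (H.in2 f) (H.in2 f)
  have hk : k₂.comp (H.in2 f) = k₁.comp (H.in2 f) := RTensor.condition _ _
  have hl : k₂.comp ((H.in1 f).comp f) = k₁.comp ((H.in1 f).comp f) := by
    rw [← in2_etaL, ← RingHom.comp_assoc, hk, RingHom.comp_assoc]
  have hr : k₂.comp ((H.in3 f).comp f) = k₁.comp ((H.in3 f).comp f) := by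
    rw [in3_comp, ← RingHom.comp_assoc, hk, RingHom.comp_assoc]
  have e : changeRing k₁ rfl N.Invariants x = changeRing k₂ hl N.Invariants x := by
    apply (ext_bijective N.ofInvariants (N.lift_ofInvariants_bijective hf.flat)
      (k₁.comp (H.in1 f)) rfl).1
    refine Eq.trans ?_ (N.glueLin_ext (p := k₁.comp (H.in1 f)) (r := k₂.comp (H.in1 f)) rfl hl _)
    rw [← changeRing_ext N.ofInvariants rfl k₁ rfl, ← changeRing_ext N.ofInvariants rfl k₂ rfl, hx,
      N.changeRing_coact₃ k₁ rfl rfl rfl, N.changeRing_coact₃ k₂ rfl hk rfl, glueLin_act₃,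
      ← transport₃_tmul_one,
      ← N.glue_ofInvariants (p := k₁.comp (H.in3 f)) (r := k₂.comp (H.in3 f)) rfl hr,
      transport₃_glue]
  obtain ⟨y, hy⟩ := exists_changeRing (in2_faithfullyFlat H hf) (H.in2_etaL f) rfl hl x e
  exact ⟨y, by rw [expand, LinearMap.comp_apply, hy, hx]⟩

/-- The function underlying the structure map of the module of invariants. -/
noncomputable def invariantsCoactFun (hf : f.FaithfullyFlat) (m : N.Invariants) :
    BaseChange H.etaL N.Invariants :=
  (N.exists_expand hf m).choose

theorem expand_invariantsCoactFun (hf : f.FaithfullyFlat) (m : N.Invariants) :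
    N.expand (N.invariantsCoactFun hf m) = N.coact₃ (N.ofInvariants m) :=
  (N.exists_expand hf m).choose_spec

/-- The structure map of the module of invariants. -/
noncomputable def invariantsCoact (hf : f.FaithfullyFlat) :
    N.Invariants →ₛₗ[H.etaR] BaseChange H.etaL N.Invariants where
  toFun := N.invariantsCoactFun hf
  map_add' m m' := by
    apply expand_injective hf
    simp only [map_add, expand_invariantsCoactFun]
  map_smul' a m := by
    apply expand_injective hf
    simp only [LinearMap.map_smulₛₗ, expand_invariantsCoactFun, in3_apply]

theorem expand_invariantsCoact (hf : f.FaithfullyFlat) (m : N.Invariants) :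
    N.expand (N.invariantsCoact hf m) = N.coact₃ (N.ofInvariants m) :=
  N.expand_invariantsCoactFun hf m

theorem ext_changeRing_invariantsCoact (hf : f.FaithfullyFlat) {p r : B →+* T} {q : Γ →+* T}
    (h : q.comp H.etaL = p.comp f) (h' : r.comp f = q.comp H.etaR) (m : N.Invariants) :
    ext N.ofInvariants p rfl (changeRing q h N.Invariants (N.invariantsCoact hf m)) =
      N.act₃ p q r h h' (N.ofInvariants m) := by
  rw [← N.changeRing_coact₃ (lift3 p q r h h') (lift3_comp_in1 ..) (lift3_comp_in2 ..)
    (lift3_comp_in3 ..), ← N.expand_invariantsCoact hf, expand, LinearMap.comp_apply,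
    changeRing_ext N.ofInvariants rfl (lift3 p q r h h') (lift3_comp_in1 ..)
      (l' := p.comp f) (by rw [← RingHom.comp_assoc, lift3_comp_in1]),
    changeRing_changeRing (H.in2_etaL f) _ (lift3_comp_in2 ..)]

theorem ext_changeRing_coactId (hf : f.FaithfullyFlat) {j : RTensor H.etaR H.etaL →+* T}
    {p s : B →+* T} {q q' : Γ →+* T} (hq : j.comp (RTensor.inl _ _) = q)
    (hq' : j.comp (RTensor.inr _ _) = q') (h : q.comp H.etaL = p.comp f)
    (h' : s.comp f = q.comp H.etaR) (hs : q'.comp H.etaL = s.comp f)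
    (hj : j.comp H.etaLL = p.comp f) (y : BaseChange H.etaL N.Invariants) :
    ext N.ofInvariants p rfl
        (changeRing j hj N.Invariants (H.coactId (N.invariantsCoact hf) y)) =
      N.transport₃ p q s h h' (ext N.ofInvariants s rfl (changeRing q' hs N.Invariants y)) := by
  induction y using BaseChange.induction_on with
  | zero => simp only [map_zero]
  | add x y hx hy => simp only [map_add, hx, hy]
  | tmul m γ =>
    have e : j (RTensor.inr _ _ γ) = q' γ := RingHom.congr_fun hq' γ
    rw [changeRing_tmul, ext_tmul, tmul_eq_smul H.etaL, tmul_eq_smul s, LinearMap.map_smulₛₗ,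
      LinearMap.map_smulₛₗ, LinearMap.map_smul, LinearMap.map_smul, e, transport₃_tmul_one,
      ← N.ext_changeRing_invariantsCoact hf]
    refine congrArg _ (congrArg _ ?_)
    refine Eq.trans (congrArg _ (BaseChange.lift_incl _ _ _ m)) ?_
    exact changeRing_changeRing rfl hj hq (N.invariantsCoact hf m)

theorem exists_faithfullyFlat_over (hf : f.FaithfullyFlat) {R : Type u} [CommRing R]
    (l s r : A →+* R) : ∃ (T : Type u) (_ : CommRing T) (j : R →+* T) (p q t : B →+* T),
      j.FaithfullyFlat ∧ p.comp f = j.comp l ∧ q.comp f = j.comp s ∧ t.comp f = j.comp r := by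
  let j₁ := RTensor.inl l f
  let j₂ := RTensor.inl (j₁.comp s) f
  let j₃ := RTensor.inl (j₂.comp (j₁.comp r)) f
  refine ⟨_, inferInstance, j₃.comp (j₂.comp j₁), j₃.comp (j₂.comp (RTensor.inr l f)),
    j₃.comp (RTensor.inr (j₁.comp s) f), RTensor.inr _ f, ?_, ?_, ?_, ?_⟩
  · exact RingHom.FaithfullyFlat.stableUnderComposition _ _
      (RingHom.FaithfullyFlat.stableUnderComposition _ _ (RTensor.inl_faithfullyFlat _ hf)
        (RTensor.inl_faithfullyFlat _ hf)) (RTensor.inl_faithfullyFlat _ hf)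
  · simp only [RingHom.comp_assoc, RTensor.condition, j₁]
  · simp only [RingHom.comp_assoc, RTensor.condition, j₁, j₂]
  · exact RTensor.condition _ _

/-- The comodule over `Γ` obtained from a comodule over `Γ_f` by faithfully flat descent. -/
noncomputable def descend (hf : f.FaithfullyFlat) : RCoMod H where
  carrier := N.Invariants
  coact := N.invariantsCoact hf
  counit m := by
    apply N.ofInvariants_injective
    apply incl_injective (φ := RingHom.id B)
      (RingHom.FaithfullyFlat.of_bijective Function.bijective_id)
    have h := N.ext_changeRing_invariantsCoact hf (p := RingHom.id B) (r := RingHom.id B)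
      (q := f.comp H.eps) (unit_etaL H f) (unit_etaR H f).symm m
    refine Eq.trans ?_ (h.trans (N.glue_self (N.ofInvariants m)))
    generalize N.invariantsCoact hf m = y
    induction y using BaseChange.induction_on with
    | zero => simp only [map_zero]
    | add x y hx hy => simp only [map_add, hx, hy]
    | tmul m γ =>
      rw [changeRing_tmul, ext_tmul, idEps, BaseChange.lift_tmul, LinearMap.map_smulₛₗ]
      exact (incl (RingHom.id B) N.carrier).map_smulₛₗ (f (H.eps γ)) (N.ofInvariants m) |>.trans
        (tmul_eq_smul (RingHom.id B) (N.ofInvariants m) (f (H.eps γ))).symm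
  coassoc m := by
    obtain ⟨T, _, j, p, s, r, hj, hp, hs, hr⟩ := exists_faithfullyFlat_over hf H.etaLL
      ((RTensor.inl H.etaR H.etaL).comp H.etaR) ((RTensor.inr H.etaR H.etaL).comp H.etaR)
    apply changeRing_injective hj hp.symm
    apply (ext_bijective N.ofInvariants (N.lift_ofInvariants_bijective hf.flat) p rfl).1
    have h₁ : (j.comp (RTensor.inl H.etaR H.etaL)).comp H.etaL = p.comp f := hp.symm
    have h₂ : s.comp f = (j.comp (RTensor.inl H.etaR H.etaL)).comp H.etaR := hs
    have h₃ : (j.comp (RTensor.inr H.etaR H.etaL)).comp H.etaL = s.comp f := by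
      rw [hs, RingHom.comp_assoc, RTensor.condition]
    have h₄ : r.comp f = (j.comp (RTensor.inr H.etaR H.etaL)).comp H.etaR := hr
    have h₅ : (j.comp H.comul).comp H.etaL = p.comp f := by
      rw [hp, RingHom.comp_assoc, H.comul_etaL, etaLL]
    have h₆ : r.comp f = (j.comp H.comul).comp H.etaR := by
      rw [hr, RingHom.comp_assoc, H.comul_etaR]
    rw [N.ext_changeRing_coactId hf rfl rfl h₁ h₂ h₃ hp.symm,
      N.ext_changeRing_invariantsCoact hf h₃ h₄,
      N.transport₃_act₃ h₁ h₂ h₃ h₄ h₅ h₆ (by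
        congr 1
        exact RTensor.hom_ext (RTensor.lift_comp_inl _ _ _) (RTensor.lift_comp_inr _ _ _)),
      ← N.ext_changeRing_invariantsCoact hf h₅ h₆]
    refine congrArg _ ?_
    exact changeRing_changeRing (ψ := H.etaLL) H.comul_etaL hp.symm rfl (N.invariantsCoact hf m)

/-- The comparison of `N` with the comodule induced by its descent. -/
noncomputable def descendHom (hf : f.FaithfullyFlat) :
    (H.toBaseChange f).pullback.obj (N.descend hf) ⟶ N where
  toLin := BaseChange.lift (RingHom.id B) (RingHom.id_comp f) N.ofInvariants
  comm x := by
    have key : ∀ y : BaseChange H.etaL N.Invariants,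
        BaseChange.map (H.in1 f) (BaseChange.lift (RingHom.id B) (RingHom.id_comp f)
          N.ofInvariants) ((H.toBaseChange f).transfer N.Invariants y) = N.expand y := by
      intro y
      induction y using BaseChange.induction_on with
      | zero => simp only [map_zero]; exact map_zero (BaseChange.map (H.in1 f) _)
      | add x y hx hy =>
        simp only [map_add, ← hx, ← hy]; exact map_add (BaseChange.map (H.in1 f) _) _ _
      | tmul m γ =>
        rw [Hom.transfer_tmul, expand_tmul]
        refine (BaseChange.map_tmul (H.in1 f) _ _ _).trans ?_
        refine congrArg (fun n => tmul (H.in1 f) n (H.in2 f γ)) ?_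
        exact BaseChange.lift_incl (RingHom.id B) (RingHom.id_comp f) N.ofInvariants m
    let u : BaseChange f N.Invariants →ₗ[B] N.carrier :=
      BaseChange.lift (RingHom.id B) (RingHom.id_comp f) N.ofInvariants
    refine semi_ext (φ := f) (M := N.Invariants) (s := N.coact.comp u)
      (t := (BaseChange.map (H.in1 f) u).comp ((H.toBaseChange f).pullbackCoact (N.descend hf)))
      (fun m => ?_) x
    refine (congrArg N.coact (BaseChange.lift_incl _ _ _ m)).trans ?_
    refine (N.expand_invariantsCoact hf m).symm.trans ?_
    rw [← key]
    exact congrArg (BaseChange.map (H.in1 f) u)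
      ((H.toBaseChange f).pullbackCoact_incl (N.descend hf) m).symm

end RCoMod

theorem essSurj_pullback_toBaseChange (H : HopfAlgebroid A Γ) (hf : f.FaithfullyFlat) :
    (H.toBaseChange f).pullback.EssSurj where
  mem_essImage N := ⟨N.descend hf, ⟨RCoMod.isoOfBijective (N.descendHom hf)
    (N.lift_ofInvariants_bijective hf.flat)⟩⟩

theorem faithful_pullback_toBaseChange (H : HopfAlgebroid A Γ) (hf : f.FaithfullyFlat) :
    (H.toBaseChange f).pullback.Faithful where
  map_injective {M N} u v h := by
    refine RCoMod.hom_ext (LinearMap.ext fun m => incl_injective hf ?_)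
    have := LinearMap.congr_fun (congrArg RCoMod.Hom.toLin h) (incl f M.carrier m)
    exact (BaseChange.map_tmul f u.toLin m 1).symm.trans
      (this.trans (BaseChange.map_tmul f v.toLin m 1))

end HopfAlgebroid

namespace HopfAlgebroid

open BaseChange

variable {A Γ B T : Type u} [CommRing A] [CommRing Γ] [CommRing B] [CommRing T]
variable {H : HopfAlgebroid A Γ} {f : A →+* B}

theorem _root_.BaseChange.exists_incl {M : Type u} [AddCommGroup M] [Module A M]
    (hf : f.FaithfullyFlat) (x : BaseChange f M)
    (hx : changeRing (RTensor.inl f f) rfl M x =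
      changeRing (RTensor.inr f f) (RTensor.condition f f) M x) :
    ∃ m, incl f M m = x := by
  obtain ⟨y, rfl⟩ := exists_changeRing hf (RingHom.comp_id f) rfl (RTensor.condition f f) x hx
  refine ⟨BaseChange.lift (RingHom.id A) (RingHom.id_comp _) LinearMap.id y, ?_⟩
  refine semi_ext (s := (incl f M).comp
    (BaseChange.lift (RingHom.id A) (RingHom.id_comp _) LinearMap.id)) (fun m => ?_) y
  rw [LinearMap.comp_apply, BaseChange.lift_tmul, changeRing_tmul, map_one, one_smul]
  simp only [map_one]; rfl

theorem transfer_toBaseChange_injective (H : HopfAlgebroid A Γ) (hf : f.FaithfullyFlat)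
    (M : Type u) [AddCommGroup M] [Module A M] :
    Function.Injective ((H.toBaseChange f).transfer M) := by
  have key : ∀ y, (H.toBaseChange f).transfer M y = ext (incl f M) (H.in1 f) rfl
      (changeRing (H.in2 f) (H.in2_etaL f) M y) := by
    intro y
    induction y using BaseChange.induction_on with
    | zero => simp only [map_zero]; rfl
    | add x y hx hy => simp only [map_add, hx, hy]; rfl
    | tmul m γ => rw [Hom.transfer_tmul, changeRing_tmul, ext_tmul]; rfl
  intro x y h
  rw [key, key] at h
  exact changeRing_injective (in2_faithfullyFlat H hf) _ ((ext_incl_bijective _ _ _).1 h)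

theorem glue_pullback_incl (M : RCoMod H) {p r : B →+* T} {l : A →+* T} (hp : p.comp f = l)
    (hr : r.comp f = l) (m : M.carrier) :
    ((H.toBaseChange f).pullback.obj M).glue p r hp hr (incl f M.carrier m) =
      tmul (M := BaseChange f M.carrier) p (incl f M.carrier m) 1 := by
  refine ((H.toBaseChange f).changeRing_pullbackCoact M _ (lift3_comp_in2 _ _ _ _ _)
    (lift3_comp_in1 _ _ _ _ _) hp (RCoMod.unit_etaL H l) (RCoMod.unit_etaR H l) m).trans ?_
  rw [M.act_eps]
  exact ext_tmul (incl f M.carrier) p hp m 1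

/-- The invariants of the comodule induced by `M` are the elements of `M`. -/
theorem exists_incl_of_glue_pullback (hf : f.FaithfullyFlat) (M : RCoMod H)
    (x : BaseChange f M.carrier)
    (hx : ((H.toBaseChange f).pullback.obj M).glue (RTensor.inl f f) (RTensor.inr f f) rfl
      (RTensor.condition f f) x = tmul (M := BaseChange f M.carrier) (RTensor.inl f f) x 1) :
    ∃ m, incl f M.carrier m = x := by
  refine exists_incl hf x ((ext_incl_bijective f (RTensor.inl f f) rfl).1 ?_)
  rw [ext_incl_changeRing]
  refine hx.symm.trans ?_
  let g : BaseChange f M.carrier →ₛₗ[RTensor.inr f f]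
      BaseChange (RTensor.inl f f) (BaseChange f M.carrier) :=
    ((H.toBaseChange f).pullback.obj M).glue (RTensor.inl f f) (RTensor.inr f f) rfl
      (RTensor.condition f f)
  refine semi_ext (s := g) (t := (ext (incl f M.carrier) (RTensor.inl f f) rfl).comp
    (changeRing (RTensor.inr f f) (RTensor.condition f f) M.carrier)) (fun m => ?_) x
  rw [LinearMap.comp_apply, changeRing_tmul, ext_tmul, map_one]
  exact glue_pullback_incl M rfl (RTensor.condition f f) m

theorem full_pullback_toBaseChange (H : HopfAlgebroid A Γ) (hf : f.FaithfullyFlat) :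
    (H.toBaseChange f).pullback.Full where
  map_surjective {M N} w := by
    let v : BaseChange f M.carrier →ₗ[B] BaseChange f N.carrier := w.toLin
    have hv : ∀ m, ∃ n, incl f N.carrier n = v (incl f M.carrier m) := by
      intro m
      apply exists_incl_of_glue_pullback hf
      refine (RCoMod.act_hom w _ (lift3_comp_in1 _ _ _ _ _) (lift3_comp_in3 _ _ _ _ _)
        (incl f M.carrier m)).trans ?_
      refine (congrArg _ (glue_pullback_incl M rfl (RTensor.condition f f) m)).trans ?_
      exact BaseChange.map_tmul (RTensor.inl f f) v (incl f M.carrier m) 1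
    choose u hu using hv
    let u' : M.carrier →ₗ[A] N.carrier :=
      { toFun := u
        map_add' := fun m m' => incl_injective hf (by simp only [map_add, hu])
        map_smul' := fun a m => incl_injective hf (by
          simp only [LinearMap.map_smulₛₗ, hu]; rfl) }
    have key : ∀ y : BaseChange H.etaL M.carrier,
        (H.toBaseChange f).transfer N.carrier (BaseChange.map H.etaL u' y) =
          BaseChange.map (H.in1 f) v ((H.toBaseChange f).transfer M.carrier y) := by
      intro y
      induction y using BaseChange.induction_on with
      | zero => simp only [map_zero]; exact (map_zero (BaseChange.map (H.in1 f) v)).symm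
      | add x y hx hy =>
        simp only [map_add, hx, hy]; exact (map_add (BaseChange.map (H.in1 f) v) _ _).symm
      | tmul m γ =>
        rw [BaseChange.map_tmul, Hom.transfer_tmul, Hom.transfer_tmul]
        refine Eq.trans ?_ (BaseChange.map_tmul (H.in1 f) v _ _).symm
        exact congrArg (fun n => tmul (H.in1 f) n (H.in2 f γ)) (hu m)
    refine ⟨{ toLin := u', comm := fun m => ?_ }, RCoMod.hom_ext ?_⟩
    · apply transfer_toBaseChange_injective H hf
      rw [key, ← Hom.pullbackCoact_incl]
      have h₁ := w.comm (incl f M.carrier m)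
      refine Eq.trans ?_ (h₁.trans ?_)
      · exact congrArg ((H.toBaseChange f).pullbackCoact N) (hu m)
      · exact congrArg (BaseChange.map (H.in1 f) v)
          ((H.toBaseChange f).pullbackCoact_incl M m)
    · refine LinearMap.ext (semi_ext (s := BaseChange.map f u') (t := v) fun m => ?_)
      rw [BaseChange.map_tmul]
      exact hu m

end HopfAlgebroid

/-- The functor from right comodules over a flat Hopf algebroid `(A, Γ)` to right comodules over
`(B, Γ_f)` induced by a faithfully flat ring homomorphism `f : A → B` is an equivalence. -/
theorem mainTheorem4 {A Γ B : Type u} [CommRing A] [CommRing Γ] [CommRing B]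
    (H : HopfAlgebroid A Γ) (hH : H.etaL.Flat) (f : A →+* B) (hf : f.FaithfullyFlat) :
    (H.toBaseChange f).pullback.IsEquivalence := by
  have := H.faithful_pullback_toBaseChange hf
  have := H.full_pullback_toBaseChange hf
  have := H.essSurj_pullback_toBaseChange hf
  exact { }
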